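/- Let $m\ge 1$ and let $(M,Z,\omega)$ be a $b^m$-symplectic manifold, so that $\omega$ is a symplectic form on $M\setminus Z$ which near the hypersurface $Z$ has smooth coefficients, and is nondegenerate up to $Z$, in the frame $z^m\partial_z,\partial_{x_2},\dots,\partial_{x_{2n}}$ of suitable local coordinates with $Z=\{z=0\}$. Let $(z,\pi)$ identify an open neighbourhood of $Z$ with $(-\varepsilon,\varepsilon)\times Z$, with $Z=\{z=0\}$, in such a way that $$\omega=\sum_{i=1}^m \frac{dz}{z^i}\wedge\pi^*\alpha_i+\pi^*\beta ,$$ where $\alpha_i\in\Omega^1(Z)$, $\beta\in\Omega^2(Z)$ are closed, $\alpha_m$ vanishes nowhere, $\beta$ is nondegenerate on $\ker\alpha_m$, and the normal $b^m$-vector field $X^\sigma=z^m\partial_z$ is symplectic, $\mathcal L_{X^\sigma}\omega=0$. Let $R$ be the Reeb vector field on $Z$, given by $\alpha_m(R)=1$ and $\iota_R\beta=0$, extended to the tube by $dz(R)=0$ and $\pi$-relatedness, and let $\mathcal N\cong\big((-\varepsilon,0)\cup(0,\varepsilon)\big)\times Z$ be the punctured tube. Put $f=\log|z|$ if $m=1$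 and $f=-\frac{1}{(m-1)z^{m-1}}$ if $m>1$. Let $\Omega\subset\mathbb C$ be open, with coordinate $\eta=s+it$. Let $H\in C^\infty(\Omega\times\mathcal N)$ be a family of Hamiltonians with $\mathcal L_{X^\sigma}H=k$ and $\mathcal L_RH=0$, where $k=k(s,t)$ is smooth and may depend on the connected component of $Z$ (every admissible Hamiltonian on $S^1\times\mathcal N$ is of this kind). For $\eta\in\Omega$ let $J_\eta$ be an almost complex structure on $\mathcal N$ that is compatible with $\omega$ and satisfies $J_\eta X^\sigma=R$. Let $u:\Omega\to\mathcal N$ be a smooth solution of the Floer equation $$\partial_su+J_\eta(u)\big(\partial_tu-X_{H}(u)\big)=0,\qquad \iota_{X_H}\omega=-dH .$$ Then: 1. $f\circ u$ is smooth and $\Delta(f\circ u)=-\dfrac{\partial k}{\partial s}$ on $\Omega$, where $k$ is taken for the component of $Z$ to which $u(\eta)$ projects. 2. If $H$ depends only on $t$ and not on $s$ (in particular for an admissible $H\in C^\infty(S^1\times\mathcal N)$), then $f\circ u$ is harmonic on $\Omega$; if moreover $\Omega$ is connected and $f\circ u$ attains its maximum or its minimum on $\Omega$, then $f\circ u$ is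 constant. 3. If $\frac{\partial k}{\partial s}\ge 0$ on $\Omega$, $\Omega$ is connected, and $f\circ u$ attains its minimum on $\Omega$, then $f\circ u$ is constant. -/

import Mathlib

open Set Manifold
open scoped ContDiff Topology

noncomputable section

namespace BmSymplectic

section Forms

variable {E : Type*} [NormedAddCommGroup E] [NormedSpace ℝ E]
  {M : Type*} [TopologicalSpace M] [ChartedSpace E M]

variable (E M) in
/-- A (not necessarily continuous) field of alternating `k`-forms on the tangent spaces of the
manifold `M`, modelled on `E`. Regularity is required separately, on open sets. -/
abbrev DiffForm (k : ℕ) : Type _ :=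
  ∀ p : M, TangentSpace 𝓘(ℝ, E) p [⋀^Fin k]→L[ℝ] ℝ

variable (E M) in
/-- A (not necessarily continuous) vector field on `M`. -/
abbrev VField : Type _ := ∀ p : M, TangentSpace 𝓘(ℝ, E) p

variable {k : ℕ}

/-- The coordinate expression of a `k`-form in the chart `e`, i.e. its pullback under `e⁻¹`.
It is meaningful on `e.target`. -/
def DiffForm.inChart (om : DiffForm E M k) (e : OpenPartialHomeomorph M E) (y : E) :
    E [⋀^Fin k]→L[ℝ] ℝ :=
  (om (e.symm y)).compContinuousLinearMap (mfderiv 𝓘(ℝ, E) 𝓘(ℝ, E) e.symm y)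

/-- The coordinate expression of a vector field in the chart `e`. -/
def VField.inChart (X : VField E M) (e : OpenPartialHomeomorph M E) (y : E) : E :=
  mfderiv 𝓘(ℝ, E) 𝓘(ℝ, E) e (e.symm y) (X (e.symm y))

/-- `om` is smooth on the open set `U`: its expression in every smooth chart is `C^∞`. -/
def DiffForm.SmoothOn (om : DiffForm E M k) (U : Set M) : Prop :=
  ∀ e ∈ IsManifold.maximalAtlas 𝓘(ℝ, E) ∞ M,
    ContDiffOn ℝ ∞ (om.inChart e) (e.target ∩ e.symm ⁻¹' U)

/-- `dom = 0` on the open set `U`, the exterior derivative being computed in smooth charts. -/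
def DiffForm.ClosedOn (om : DiffForm E M k) (U : Set M) : Prop :=
  ∀ e ∈ IsManifold.maximalAtlas 𝓘(ℝ, E) ∞ M, ∀ y ∈ e.target, e.symm y ∈ U →
    extDeriv (om.inChart e) y = 0

/-- The Lie derivative `L_X om` of a `k`-form on a vector space along a vector field:
`(L_X om)(v₁, …, vₖ) = (D_X om)(v₁, …, vₖ) + ∑ i, om(v₁, …, D_{vᵢ} X, …, vₖ)`. -/
def lieDerivForm (X : E → E) (om : E → E [⋀^Fin k]→L[ℝ] ℝ) (y : E) (v : Fin k → E) : ℝ :=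
  fderiv ℝ om y (X y) v + ∑ i, om y (Function.update v i (fderiv ℝ X y (v i)))

/-- `X` is a smooth vector field on the open set `U` and `L_X om = 0` there
(computed in smooth charts). -/
structure IsSymplecticVField (X : VField E M) (om : DiffForm E M 2) (U : Set M) : Prop where
  smooth : ∀ e ∈ IsManifold.maximalAtlas 𝓘(ℝ, E) ∞ M,
    ContDiffOn ℝ ∞ (X.inChart e) (e.target ∩ e.symm ⁻¹' U)
  lie_eq_zero : ∀ e ∈ IsManifold.maximalAtlas 𝓘(ℝ, E) ∞ M, ∀ y ∈ e.target, e.symm y ∈ U →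
    ∀ v : Fin 2 → E, lieDerivForm (X.inChart e) (om.inChart e) y v = 0

/-- The linear map of `E` which is the identity on `ker l` and multiplies `e₀` by `r`
(where `l e₀ = 1`). With `l` the coordinate defining a hypersurface and `r = l ^ m`, it maps the
frame `∂_z, ∂_{x_2}, …` to the frame `z ^ m ∂_z, ∂_{x_2}, …`. -/
def frameScale (l : E →L[ℝ] ℝ) (e₀ : E) (r : ℝ) : E →L[ℝ] E :=
  ContinuousLinearMap.id ℝ E + (r - 1) • l.smulRight e₀

/-- `om` is a `b^m`-symplectic form on `M` with critical hypersurface `S`.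

Away from `S` it is a symplectic form. Each point of `S` has a slice chart in which `S` is the
zero set of a linear coordinate `l`, and the coefficients of `om` in the frame
`z ^ m ∂_z, ∂_{x_2}, …` (with `z = l`) of the `b^m`-tangent bundle extend to a
smooth form on the whole chart, which is nondegenerate at every point, those of `S` included. -/
structure IsBmSymplectic (m : ℕ) (om : DiffForm E M 2) (S : Set M) : Prop where
  isClosed : IsClosed S
  smooth : om.SmoothOn Sᶜ
  closed : om.ClosedOn Sᶜ
  nondegenerate : ∀ p ∉ S, ∀ v : TangentSpace 𝓘(ℝ, E) p, (∀ w, om p ![v, w] = 0) → v = 0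
  near : ∀ p ∈ S, ∃ e ∈ IsManifold.maximalAtlas 𝓘(ℝ, E) ∞ M, p ∈ e.source ∧
    ∃ (l : E →L[ℝ] ℝ) (e₀ : E), l e₀ = 1 ∧ (∀ q ∈ e.source, q ∈ S ↔ l (e q) = 0) ∧
    ∃ B : E → E [⋀^Fin 2]→L[ℝ] ℝ, ContDiffOn ℝ ∞ B e.target ∧
      (∀ y ∈ e.target, ∀ v, (∀ w, B y ![v, w] = 0) → v = 0) ∧
      ∀ y ∈ e.target, l y ≠ 0 →
        B y = (om.inChart e y).compContinuousLinearMap (frameScale l e₀ (l y ^ m))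

end Forms

section Tube

variable {E : Type*} [NormedAddCommGroup E] [NormedSpace ℝ E]
  {M : Type*} [TopologicalSpace M] [ChartedSpace E M]
  {F : Type*} [NormedAddCommGroup F] [NormedSpace ℝ F]
  {Z : Type*} [TopologicalSpace Z] [ChartedSpace F Z]

variable (E M F Z) in
/-- A tubular neighbourhood of the hypersurface `S ⊆ M`: a diffeomorphism `(z, π)` from an open
neighbourhood of `S` onto `(-ε, ε) × Z`, for which `S = {z = 0}`. In particular `π` identifies `S`
with the manifold `Z`, and `z` is a defining function of `S`. -/
structure Tube (S : Set M) where
  /-- The diffeomorphism `(z, π)`. -/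
  toHomeo : OpenPartialHomeomorph M (ℝ × Z)
  /-- The width of the tube. -/
  ε : ℝ
  ε_pos : 0 < ε
  target_eq : toHomeo.target = Ioo (-ε) ε ×ˢ (univ : Set Z)
  smooth : ContMDiffOn 𝓘(ℝ, E) (𝓘(ℝ, ℝ).prod 𝓘(ℝ, F)) ∞ toHomeo toHomeo.source
  smooth_symm : ContMDiffOn (𝓘(ℝ, ℝ).prod 𝓘(ℝ, F)) 𝓘(ℝ, E) ∞ toHomeo.symm toHomeo.target
  subset_source : S ⊆ toHomeo.source
  mem_iff : ∀ p ∈ toHomeo.source, p ∈ S ↔ (toHomeo p).1 = 0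

namespace Tube

variable {S : Set M} (T : Tube E M F Z S)

/-- The defining function `z` of the hypersurface. -/
def z (p : M) : ℝ := (T.toHomeo p).1

/-- The projection `π` of the tube onto the hypersurface. -/
def proj (p : M) : Z := (T.toHomeo p).2

/-- The punctured tube, diffeomorphic to `((-ε, 0) ∪ (0, ε)) × Z`. -/
def punctured : Set M := T.toHomeo.source \ S

/-- The differential `dz`. -/
def dz (p : M) : TangentSpace 𝓘(ℝ, E) p →L[ℝ] ℝ :=
  mfderiv 𝓘(ℝ, E) 𝓘(ℝ, ℝ) T.z p

/-- The differential `dπ`. -/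
def dproj (p : M) : TangentSpace 𝓘(ℝ, E) p →L[ℝ] TangentSpace 𝓘(ℝ, F) (T.proj p) :=
  mfderiv 𝓘(ℝ, E) 𝓘(ℝ, F) T.proj p

/-- The vector field on the tube that is equal to `a ∂_z + Y` under the identification with
`(-ε, ε) × Z`, where `a` is a function of `z`, and `Y` is a vector field on `Z`. -/
def lift (a : ℝ → ℝ) (Y : VField F Z) : VField E M := fun p =>
  mfderiv (𝓘(ℝ, ℝ).prod 𝓘(ℝ, F)) 𝓘(ℝ, E) T.toHomeo.symm (T.toHomeo p)
    ((a (T.z p), Y (T.proj p)) : ℝ × TangentSpace 𝓘(ℝ, F) (T.proj p))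

/-- The vector field `X^σ = z ^ m ∂_z` on the tube. -/
def normalField (m : ℕ) : VField E M := T.lift (fun r => r ^ m) (fun _ => 0)

/-- The extension to the tube of a vector field on the hypersurface. -/
def extend (R : VField F Z) : VField E M := T.lift (fun _ => 0) R

/-- The connected component of the hypersurface to which a point of the tube projects. -/
def component (p : M) : ConnectedComponents Z := ConnectedComponents.mk (T.proj p)

/-- The function `f = log |z|` if `m = 1`, and `f = - 1 / ((m - 1) z ^ (m - 1))` if `m > 1`. -/
def f (m : ℕ) (p : M) : ℝ :=
  if m = 1 then Real.log |T.z p| else -(1 / (((m : ℝ) - 1) * T.z p ^ (m - 1)))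

/-- The choices made near the critical hypersurface of a `b^m`-symplectic form `om`: the
coordinates `(z, π)` of the tube are such that
`om = ∑_{i = 1}^m z^{-i} dz ∧ π^*α_i + π^*β` for closed forms `α_i`, `β` on `Z`, where `(α_m, β)` is
a cosymplectic structure on `Z` (`α_m` vanishes nowhere and `β` is nondegenerate on `ker α_m`), and
such that `X^σ = z ^ m ∂_z` is a normal symplectic `b^m`-vector field. -/
structure IsAdapted (m : ℕ) (om : DiffForm E M 2) (α : ℕ → DiffForm F Z 1) (β : DiffForm F Z 2) :
    Prop where
  α_smooth : ∀ i ∈ Finset.Icc 1 m, (α i).SmoothOn univ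
  α_closed : ∀ i ∈ Finset.Icc 1 m, (α i).ClosedOn univ
  β_smooth : β.SmoothOn univ
  β_closed : β.ClosedOn univ
  α_ne_zero : ∀ x : Z, α m x ≠ 0
  β_leafwise : ∀ (x : Z) (v : TangentSpace 𝓘(ℝ, F) x), α m x ![v] = 0 →
    (∀ w : TangentSpace 𝓘(ℝ, F) x, α m x ![w] = 0 → β x ![v, w] = 0) → v = 0
  laurent : ∀ p ∈ T.punctured, ∀ v w : TangentSpace 𝓘(ℝ, E) p,
    om p ![v, w] =
      ∑ i ∈ Finset.Icc 1 m, (T.z p ^ i)⁻¹ *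
        (T.dz p v * α i (T.proj p) ![T.dproj p w] - T.dz p w * α i (T.proj p) ![T.dproj p v])
      + β (T.proj p) ![T.dproj p v, T.dproj p w]
  symplectic : IsSymplecticVField (T.normalField m) om T.punctured

end Tube

/-- `R` is the Reeb vector field of the cosymplectic structure `(α, β)`:
`α(R) = 1` and `ι_R β = 0`. -/
def IsReeb (α : DiffForm F Z 1) (β : DiffForm F Z 2) (R : VField F Z) : Prop :=
  ∀ x : Z, α x ![R x] = 1 ∧ ∀ v : TangentSpace 𝓘(ℝ, F) x, β x ![R x, v] = 0

end Tube

section Floer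

variable {E : Type*} [NormedAddCommGroup E] [NormedSpace ℝ E]
  {M : Type*} [TopologicalSpace M] [ChartedSpace E M]

/-- The derivative `dH(v)` of a function on `M` in the direction of a tangent vector. -/
def dirDeriv (H : M → ℝ) (p : M) (v : TangentSpace 𝓘(ℝ, E) p) : ℝ :=
  mfderiv 𝓘(ℝ, E) 𝓘(ℝ, ℝ) H p v

/-- `w` is the value at `p` of the Hamiltonian vector field of `H`: `ι_w om = - dH` at `p`. -/
def IsHamiltonianVector (om : DiffForm E M 2) (H : M → ℝ) (p : M)
    (w : TangentSpace 𝓘(ℝ, E) p) : Prop :=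
  ∀ v, om p ![w, v] = -dirDeriv H p v

/-- At the point `p`, the endomorphism `J` is a complex structure compatible with `om`, and
`J X = R`. -/
structure IsAdaptedACSAt (om : DiffForm E M 2) (X R : VField E M) (p : M)
    (J : TangentSpace 𝓘(ℝ, E) p →L[ℝ] TangentSpace 𝓘(ℝ, E) p) : Prop where
  sq : ∀ v, J (J v) = -v
  invariant : ∀ v w, om p ![J v, J w] = om p ![v, w]
  positive : ∀ v, v ≠ 0 → 0 < om p ![v, J v]
  map_X : J (X p) = R p

/-- The partial derivative `∂_s` of a real function of `η = s + i t`. -/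
def partialS (g : ℂ → ℝ) (η : ℂ) : ℝ := fderiv ℝ g η 1

/-- The Hamiltonians `H η`, parametrized by `η ∈ Ω`, are smooth on `N`, linear along `X` with
slope `k c η` over the connected component labelled by `c`, and invariant along `R`. -/
structure IsAdmissible {C : Type*} (X R : VField E M) (N : Set M) (comp : M → C) (Ω : Set ℂ)
    (H : ℂ → M → ℝ) (k : C → ℂ → ℝ) : Prop where
  smooth : ContMDiffOn (𝓘(ℝ, ℂ).prod 𝓘(ℝ, E)) 𝓘(ℝ, ℝ) ∞
    (fun q : ℂ × M => H q.1 q.2) (Ω ×ˢ N)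
  k_smooth : ∀ c, ContDiffOn ℝ ∞ (k c) Ω
  linear : ∀ η ∈ Ω, ∀ p ∈ N, dirDeriv (H η) p (X p) = k (comp p) η
  reeb_invariant : ∀ η ∈ Ω, ∀ p ∈ N, dirDeriv (H η) p (R p) = 0

/-- `u : Ω → N` is a smooth solution of the Floer equation
`∂_s u + J(η, u) (∂_t u - X_H(u)) = 0`, where `η = s + i t`. -/
structure IsFloerSolution (om : DiffForm E M 2) (N : Set M) (Ω : Set ℂ) (H : ℂ → M → ℝ)
    (J : ℂ → ∀ p : M, TangentSpace 𝓘(ℝ, E) p →L[ℝ] TangentSpace 𝓘(ℝ, E) p)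
    (u : ℂ → M) : Prop where
  smooth : ContMDiffOn 𝓘(ℝ, ℂ) 𝓘(ℝ, E) ∞ u Ω
  mapsTo : MapsTo u Ω N
  floer : ∀ η ∈ Ω, ∃ w : TangentSpace 𝓘(ℝ, E) (u η), IsHamiltonianVector om (H η) (u η) w ∧
    mfderiv 𝓘(ℝ, ℂ) 𝓘(ℝ, E) u η (1 : ℂ)
      + J η (u η) (mfderiv 𝓘(ℝ, ℂ) 𝓘(ℝ, E) u η Complex.I - w) = 0

end Floer

end BmSymplectic

end

/-!
The function `f` is a primitive of `z ^ (-m)`, so that `df = z ^ (-m) dz`.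

Computing `L_{X^σ} om` in the chart of `M` given by the tube coordinates and a chart of `Z`
(`Tube.chart`) shows that `∑ i, (m - i) z ^ (m - 1 - i) α_i = 0` for all `z ≠ 0`. Thus `α_i = 0` for
`i < m` (`Tube.IsAdapted.form_eq_zero`), and `om = z ^ (-m) dz ∧ π^*α_m + π^*β`. It follows that
`ι_{X^σ} om = π^*α_m` and `ι_R om = - df`.

As `J X^σ = R`, pairing the Floer equation with `R` and with `X^σ` yields
(`Tube.fderiv_f_comp_floer`)
`∂_s (f ∘ u) = α_m(dπ ∂_t u) - k` and `∂_t (f ∘ u) = - α_m(dπ ∂_s u)`.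
The form `(π ∘ u)^*α_m` is closed (`DiffForm.fderiv_pullback_symm`), so differentiating these two
equations and adding gives `Δ(f ∘ u) = - ∂k/∂s` (`Tube.laplacian_f_comp`).

The statements on extrema follow from the strong maximum principle for `C²` subharmonic functions
in the plane (`eq_of_subharmonic_of_isMaxOn`), proved with Hopf's barrier on a disc touching the set
where the maximum is attained.
-/

namespace BmSymplectic

open Filter Metric Laplacian

/-! ### The strong maximum principle in the plane -/

theorem laplacian_complex_apply (h : ℂ → ℝ) (x : ℂ) :
    Δ h x = fderiv ℝ (fderiv ℝ h) x 1 1 + fderiv ℝ (fderiv ℝ h) x Complex.I Complex.I := by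
  rw [InnerProductSpace.laplacian_eq_iteratedFDeriv_complexPlane]
  simp [iteratedFDeriv_two_apply]

theorem deriv_comp_line_eventuallyEq {h : ℂ → ℝ} {x : ℂ} (hc : ContDiffAt ℝ 2 h x) (v : ℂ) :
    deriv (fun t : ℝ => h (x + t * v)) =ᶠ[𝓝 0] fun t => fderiv ℝ h (x + t * v) v := by
  have h1 : ∀ᶠ y in 𝓝 x, DifferentiableAt ℝ h y :=
    (hc.eventually (by simp)).mono fun y hy => hy.differentiableAt (by simp)
  have hcont : Tendsto (fun t : ℝ => x + t * v) (𝓝 0) (𝓝 x) := by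
    have : Continuous (fun t : ℝ => x + t * v) := by fun_prop
    simpa using this.tendsto 0
  filter_upwards [hcont.eventually h1] with t ht
  have hl : HasDerivAt (fun t : ℝ => x + t * v) v t := by
    simpa using ((Complex.ofRealCLM.hasDerivAt (x := t)).mul_const v).const_add x
  exact (ht.hasFDerivAt.comp_hasDerivAt t hl).deriv

theorem deriv_deriv_comp_line {h : ℂ → ℝ} {x : ℂ} (hc : ContDiffAt ℝ 2 h x) (v : ℂ) :
    deriv (deriv (fun t : ℝ => h (x + t * v))) 0 = fderiv ℝ (fderiv ℝ h) x v v := by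
  rw [(deriv_comp_line_eventuallyEq hc v).deriv_eq]
  have h2 : DifferentiableAt ℝ (fderiv ℝ h) x :=
    (hc.fderiv_right (m := 1) (by norm_num)).differentiableAt (by simp)
  have hl : HasDerivAt (fun t : ℝ => x + t * v) v 0 := by
    simpa using ((Complex.ofRealCLM.hasDerivAt (x := 0)).mul_const v).const_add x
  have h3 : HasFDerivAt (fderiv ℝ h) (fderiv ℝ (fderiv ℝ h) x) (x + (0 : ℝ) * v) := by
    simpa using h2.hasFDerivAt
  have h4 : HasDerivAt (fun t : ℝ => fderiv ℝ h (x + t * v)) (fderiv ℝ (fderiv ℝ h) x v) 0 :=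
    h3.comp_hasDerivAt (0 : ℝ) hl
  exact ((ContinuousLinearMap.apply ℝ ℝ v).hasFDerivAt.comp_hasDerivAt (0 : ℝ) h4).deriv

/-- The second derivative test, in the form that a positive Laplacian excludes local maxima. -/
theorem not_isLocalMax_of_laplacian_pos {h : ℂ → ℝ} {x : ℂ} (hc : ContDiffAt ℝ 2 h x)
    (hpos : 0 < Δ h x) : ¬ IsLocalMax h x := by
  intro hmax
  have key : ∀ v : ℂ, fderiv ℝ (fderiv ℝ h) x v v ≤ 0 := by
    intro v
    by_contra! hv
    have hcont : Continuous (fun t : ℝ => x + t * v) := by fun_prop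
    have hmax' : IsLocalMax (fun t : ℝ => h (x + t * v)) 0 := by
      have : Tendsto (fun t : ℝ => x + t * v) (𝓝 0) (𝓝 x) := by simpa using hcont.tendsto 0
      have := this.eventually hmax
      filter_upwards [this] with t ht
      simpa using ht
    have hmin : IsLocalMin (fun t : ℝ => h (x + t * v)) 0 := by
      refine isLocalMin_of_deriv_deriv_pos ?_ hmax'.deriv_eq_zero ?_
      · rwa [deriv_deriv_comp_line hc v]
      · have h0 : ContinuousAt h (x + (0 : ℝ) * v) := by simpa using hc.continuousAt
        exact ContinuousAt.comp (f := fun t : ℝ => x + t * v) h0 hcont.continuousAt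
    have hconst : (fun t : ℝ => h (x + t * v)) =ᶠ[𝓝 0] fun _ => h (x + (0 : ℝ) * v) := by
      filter_upwards [hmax', hmin] with t h1 h2 using le_antisymm h1 h2
    have hz := hconst.deriv.deriv_eq
    rw [deriv_deriv_comp_line hc v] at hz
    simp at hz
    exact hv.ne' hz
  rw [laplacian_complex_apply] at hpos
  linarith [key 1, key Complex.I]

theorem contDiff_gaussian (a : ℝ) (c : ℂ) {n : WithTop ℕ∞} :
    ContDiff ℝ n (fun x : ℂ => Real.exp (-a * ‖x - c‖ ^ 2)) :=
  Real.contDiff_exp.comp (contDiff_const.mul ((contDiff_id.sub contDiff_const).norm_sq ℝ))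

theorem deriv_deriv_exp_quadratic (a p q : ℝ) :
    deriv (deriv (fun t : ℝ => Real.exp (-a * ((p + t) ^ 2 + q ^ 2)))) 0 =
      (4 * a ^ 2 * p ^ 2 - 2 * a) * Real.exp (-a * (p ^ 2 + q ^ 2)) := by
  have hin : ∀ t : ℝ, HasDerivAt (fun t : ℝ => -a * ((p + t) ^ 2 + q ^ 2)) (-a * (2 * (p + t))) t := by
    intro t
    have := ((((hasDerivAt_id t).const_add p).pow 2).add_const (q ^ 2)).const_mul (-a)
    simpa using this
  have h1 : deriv (fun t : ℝ => Real.exp (-a * ((p + t) ^ 2 + q ^ 2))) =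
      fun t => Real.exp (-a * ((p + t) ^ 2 + q ^ 2)) * (-a * (2 * (p + t))) := by
    funext t
    exact (hin t).exp.deriv
  rw [h1]
  have h2 : HasDerivAt (fun t : ℝ => -a * (2 * (p + t))) (-a * 2) 0 := by
    simpa using ((((hasDerivAt_id (0 : ℝ)).const_add p).const_mul 2).const_mul (-a))
  refine ((hin 0).exp.mul h2).deriv.trans ?_
  simp only [add_zero]
  ring

theorem laplacian_gaussian (a : ℝ) (c x : ℂ) :
    Δ (fun x : ℂ => Real.exp (-a * ‖x - c‖ ^ 2)) x =
      4 * a * (a * ‖x - c‖ ^ 2 - 1) * Real.exp (-a * ‖x - c‖ ^ 2) := by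
  have hc : ContDiffAt ℝ 2 (fun x : ℂ => Real.exp (-a * ‖x - c‖ ^ 2)) x :=
    (contDiff_gaussian a c).contDiffAt
  have hn : ∀ w : ℂ, ‖w‖ ^ 2 = w.re ^ 2 + w.im ^ 2 := by
    intro w
    rw [← Complex.normSq_eq_norm_sq, Complex.normSq_apply]; ring
  rw [laplacian_complex_apply, ← deriv_deriv_comp_line hc, ← deriv_deriv_comp_line hc]
  have e1 : (fun t : ℝ => Real.exp (-a * ‖x + t * 1 - c‖ ^ 2)) =
      fun t => Real.exp (-a * (((x - c).re + t) ^ 2 + (x - c).im ^ 2)) := by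
    funext t
    rw [hn]
    simp only [Complex.sub_re, Complex.add_re, Complex.sub_im, Complex.add_im, mul_one,
      Complex.ofReal_re, Complex.ofReal_im]
    ring_nf
  have e2 : (fun t : ℝ => Real.exp (-a * ‖x + t * Complex.I - c‖ ^ 2)) =
      fun t => Real.exp (-a * (((x - c).im + t) ^ 2 + (x - c).re ^ 2)) := by
    funext t
    rw [hn]
    simp only [Complex.sub_re, Complex.add_re, Complex.sub_im, Complex.add_im, Complex.mul_re,
      Complex.mul_im, Complex.I_re, Complex.I_im, Complex.ofReal_re, Complex.ofReal_im]
    ring_nf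
  rw [e1, e2, deriv_deriv_exp_quadratic, deriv_deriv_exp_quadratic, hn,
    add_comm ((x - c).im ^ 2)]
  ring

/-- Hopf's argument: a subharmonic function on `Ω` cannot attain its maximum at a boundary point
`y` of a disc while being smaller than `h y` in the rest of the closed disc. Otherwise, adding
a small multiple of the barrier `exp (-a ‖x - c‖²)`, where `a` is so large that the barrier is
strictly subharmonic near `y`, would give a function with positive Laplacian and with an interior
maximum in a small disc around `y`. -/
theorem false_of_subharmonic_of_touching_disc {h : ℂ → ℝ} {Ω : Set ℂ} (hΩ : IsOpen Ω)
    (hc : ContDiffOn ℝ 2 h Ω) (hΔ : ∀ x ∈ Ω, 0 ≤ Δ h x) {c y : ℂ} {r : ℝ} (hr : 0 < r)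
    (hy : dist y c = r) (hyΩ : y ∈ Ω) (hmax : ∀ x ∈ Ω, h x ≤ h y)
    (hlt : ∀ x ∈ closedBall c r ∩ Ω, x ≠ y → h x < h y) : False := by
  obtain ⟨ρ₀, hρ₀, hball₀⟩ := Metric.isOpen_iff.1 hΩ y hyΩ
  set ρ := min (ρ₀ / 2) (r / 2) with hρdef
  have hρ : 0 < ρ := by positivity
  have hballΩ : closedBall y ρ ⊆ Ω :=
    (closedBall_subset_ball (by have := min_le_left (ρ₀ / 2) (r / 2); linarith)).trans hball₀
  have hρr : ρ ≤ r / 2 := min_le_right _ _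
  -- `Δ exp (-a ‖x - c‖²)` is positive where `a ‖x - c‖² > 1`, hence on the disc of radius
  -- `ρ ≤ r / 2` around `y`, where `‖x - c‖ ≥ r / 2`
  set a : ℝ := 8 / r ^ 2 with ha
  have ha0 : 0 < a := by positivity
  set v : ℂ → ℝ := fun x => Real.exp (-a * ‖x - c‖ ^ 2) with hv
  have hvc : ContDiff ℝ 2 v := contDiff_gaussian a c
  have hvle : ∀ x, v x ≤ 1 := fun x => Real.exp_le_one_iff.2 (by nlinarith [sq_nonneg ‖x - c‖])
  have hvy : v y = Real.exp (-a * r ^ 2) := by simp [hv, ← hy, dist_eq_norm]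
  have hcont : ContinuousOn h (closedBall y ρ) := hc.continuousOn.mono hballΩ
  -- a uniform gap on the part of the small circle that lies in the closed disc
  obtain ⟨δ, hδ, hgap⟩ : ∃ δ > 0, ∀ x ∈ sphere y ρ ∩ closedBall c r, h x ≤ h y - δ := by
    have hK : IsCompact (sphere y ρ ∩ closedBall c r) :=
      (isCompact_sphere y ρ).inter_right isClosed_closedBall
    rcases (sphere y ρ ∩ closedBall c r).eq_empty_or_nonempty with he | hne
    · exact ⟨1, one_pos, by simp [he]⟩
    · obtain ⟨x₀, hx₀, hx₀max⟩ := hK.exists_isMaxOn hne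
        (hcont.mono (inter_subset_left.trans sphere_subset_closedBall))
      refine ⟨h y - h x₀, sub_pos.2 (hlt x₀ ⟨hx₀.2, hballΩ (sphere_subset_closedBall hx₀.1)⟩ ?_), ?_⟩
      · exact ne_of_mem_sphere hx₀.1 hρ.ne'
      · intro x hx
        have := hx₀max hx
        simp only [mem_ofPred_eq] at this
        linarith
  set w : ℂ → ℝ := h + (δ / 2) • v with hw
  have hvs : ContDiff ℝ 2 ((δ / 2) • v) := contDiff_const.smul hvc
  have hwc : ∀ x ∈ Ω, ContDiffAt ℝ 2 w x := fun x hx =>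
    (hc.contDiffAt (hΩ.mem_nhds hx)).add hvs.contDiffAt
  have hbd : ∀ x ∈ sphere y ρ, w x < w y := by
    intro x hx
    simp only [hw, Pi.add_apply, Pi.smul_apply, smul_eq_mul]
    by_cases hxc : x ∈ closedBall c r
    · have h1 := hgap x ⟨hx, hxc⟩
      have h2 := hvle x
      have h3 : 0 < v y := Real.exp_pos _
      nlinarith
    -- outside the disc it is the barrier that is smaller than at `y`
    · have h1 := hmax x (hballΩ (sphere_subset_closedBall hx))
      have h2 : v x < v y := by
        rw [hvy, hv]
        apply Real.exp_lt_exp.2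
        have h3 : r < ‖x - c‖ := by simpa [dist_eq_norm] using hxc
        have h4 : r ^ 2 < ‖x - c‖ ^ 2 := by gcongr
        nlinarith
      nlinarith
  obtain ⟨p, hp, hpmax⟩ := (isCompact_closedBall y ρ).exists_isMaxOn
    ⟨y, mem_closedBall_self hρ.le⟩ (fun x hx => (hwc x (hballΩ hx)).continuousAt.continuousWithinAt)
  have hpy : w y ≤ w p := hpmax (mem_closedBall_self hρ.le)
  have hpball : p ∈ ball y ρ := by
    rcases (mem_closedBall.1 hp).lt_or_eq with h1 | h1
    · exact h1
    · exact absurd (hbd p h1) (not_lt.2 hpy)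
  have hlocmax : IsLocalMax w p :=
    hpmax.isLocalMax (mem_of_superset (isOpen_ball.mem_nhds hpball) ball_subset_closedBall)
  refine not_isLocalMax_of_laplacian_pos (hwc p (hballΩ hp)) ?_ hlocmax
  have hadd : Δ w p = Δ h p + (δ / 2) * Δ v p := by
    rw [hw, (hc.contDiffAt (hΩ.mem_nhds (hballΩ hp))).laplacian_add
      hvs.contDiffAt, InnerProductSpace.laplacian_smul _ hvc.contDiffAt, smul_eq_mul]
  have hpc : r / 2 ≤ ‖p - c‖ := by
    have h1 : dist y c ≤ dist y p + dist p c := dist_triangle _ _ _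
    have h2 : dist y p < ρ := by rw [dist_comm]; exact hpball
    rw [← dist_eq_norm]; linarith
  have hΔv : 0 < Δ v p := by
    rw [hv, laplacian_gaussian]
    have h1 : (r / 2) ^ 2 ≤ ‖p - c‖ ^ 2 := by gcongr
    have h2 : a * (r / 2) ^ 2 = 2 := by rw [ha]; field_simp; norm_num
    have h3 : 2 ≤ a * ‖p - c‖ ^ 2 := h2 ▸ mul_le_mul_of_nonneg_left h1 ha0.le
    have h4 : 0 < a * ‖p - c‖ ^ 2 - 1 := by linarith
    positivity
  rw [hadd]
  have := hΔ p (hballΩ hp)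
  positivity

/-- The strong maximum principle for twice continuously differentiable subharmonic functions
in the plane. -/
theorem eq_of_subharmonic_of_isMaxOn {h : ℂ → ℝ} {Ω : Set ℂ} (hΩ : IsOpen Ω)
    (hc : ContDiffOn ℝ 2 h Ω) (hΔ : ∀ x ∈ Ω, 0 ≤ Δ h x) (hconn : IsPreconnected Ω) {x₀ : ℂ}
    (hx₀ : x₀ ∈ Ω) (hmax : IsMaxOn h Ω x₀) : ∀ x ∈ Ω, h x = h x₀ := by
  have hmax' : ∀ x ∈ Ω, h x ≤ h x₀ := fun x hx => hmax hx
  -- the maximum set is open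
  have hopen : ∀ y ∈ Ω, h y = h x₀ → ∀ᶠ x in 𝓝 y, h x = h x₀ := by
    intro y hy hhy
    obtain ⟨ρ, hρ, hball⟩ := Metric.isOpen_iff.1 hΩ y hy
    set r := ρ / 4 with hr
    have hr0 : 0 < r := by positivity
    have hcb : closedBall y (2 * r) ⊆ Ω :=
      (closedBall_subset_ball (by linarith)).trans hball
    filter_upwards [ball_mem_nhds y hr0] with x₁ hx₁
    by_contra hne
    -- the point of the maximum set closest to `x₁`
    set A := closedBall y (2 * r) ∩ h ⁻¹' {h x₀} with hA
    have hAc : IsCompact A := by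
      refine (isCompact_closedBall y (2 * r)).of_isClosed_subset ?_ inter_subset_left
      exact (hc.continuousOn.mono hcb).preimage_isClosed_of_isClosed isClosed_closedBall
        isClosed_singleton
    have hyA : y ∈ A := ⟨mem_closedBall_self (by positivity), hhy⟩
    obtain ⟨y', hy'A, hy'⟩ := hAc.exists_infDist_eq_dist ⟨y, hyA⟩ x₁
    set R := dist x₁ y' with hR
    have hRle : ∀ x ∈ A, R ≤ dist x₁ x := fun x hx => hy' ▸ infDist_le_dist_of_mem hx
    have hRr : R < r := (hRle y hyA).trans_lt hx₁
    have hx₁A : x₁ ∉ A := fun hx => hne hx.2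
    have hR0 : 0 < R := dist_pos.2 fun he => hx₁A (he ▸ hy'A)
    have hyx : dist x₁ y < r := hx₁
    -- the disc with diameter from `x₁` to `y'` meets the maximum set in `y'` only
    set c := midpoint ℝ x₁ y' with hcdef
    have hcx : c - x₁ = (1 / 2 : ℝ) • (y' - x₁) := by
      rw [hcdef, midpoint_eq_smul_add, invOf_eq_inv]; module
    have hcy : y' - c = (1 / 2 : ℝ) • (y' - x₁) := by
      rw [hcdef, midpoint_eq_smul_add, invOf_eq_inv]; module
    have hnorm : ‖(1 / 2 : ℝ) • (y' - x₁)‖ = R / 2 := by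
      rw [norm_smul, ← dist_eq_norm, dist_comm, ← hR]; norm_num; ring
    refine false_of_subharmonic_of_touching_disc hΩ hc hΔ (c := c) (y := y') (r := R / 2)
      (by positivity) (by rw [dist_eq_norm, hcy, hnorm]) (hcb hy'A.1) ?_ ?_
    · intro x hx
      rw [show h y' = h x₀ from hy'A.2]
      exact hmax' x hx
    · rintro x ⟨hxc, hxΩ⟩ hxy
      rw [show h y' = h x₀ from hy'A.2]
      refine lt_of_le_of_ne (hmax' x hxΩ) fun hxA => ?_
      have hxR : dist x₁ x < R := by
        have hpar := parallelogram_law_with_norm ℝ (x - c) ((1 / 2 : ℝ) • (y' - x₁))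
        have e1 : x - c + (1 / 2 : ℝ) • (y' - x₁) = x - x₁ := by rw [← hcx]; abel
        have e2 : x - c - (1 / 2 : ℝ) • (y' - x₁) = x - y' := by rw [← hcy]; abel
        rw [e1, e2, hnorm] at hpar
        have h1 : ‖x - c‖ ≤ R / 2 := by rw [← dist_eq_norm]; exact hxc
        have h2 : 0 < ‖x - y'‖ := norm_pos_iff.2 (sub_ne_zero.2 hxy)
        rw [dist_comm, dist_eq_norm]
        nlinarith [norm_nonneg (x - c), norm_nonneg (x - x₁)]
      have hxcb : x ∈ closedBall y (2 * r) := by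
        rw [mem_closedBall]
        have := dist_triangle x x₁ y
        rw [dist_comm x x₁] at this
        linarith
      exact absurd (hRle x ⟨hxcb, hxA⟩) (not_le.2 hxR)
  -- hence it is all of `Ω`
  have hsub : Ω ⊆ {x | x ∈ Ω ∧ h x = h x₀} := by
    refine hconn.subset_of_closure_inter_subset ?_ ⟨x₀, hx₀, hx₀, rfl⟩ ?_
    · rw [isOpen_iff_mem_nhds]
      rintro x ⟨hx, hxm⟩
      exact (hΩ.eventually_mem hx).and (hopen x hx hxm)
    · rintro x ⟨hxcl, hxΩ⟩
      refine ⟨hxΩ, ?_⟩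
      have hcx : ContinuousAt h x := (hc.contDiffAt (hΩ.mem_nhds hxΩ)).continuousAt
      have hcl : h x ∈ closure {h x₀} :=
        closure_mono (by rintro _ ⟨y, hy, rfl⟩; exact hy.2)
          (mem_closure_image hcx hxcl)
      simpa using hcl
  exact fun x hx => (hsub hx).2

/-! ### Values of forms -/

variable {E : Type*} [NormedAddCommGroup E] [NormedSpace ℝ E]
  {M : Type*} [TopologicalSpace M] [ChartedSpace E M]
  {F : Type*} [NormedAddCommGroup F] [NormedSpace ℝ F]
  {Z : Type*} [TopologicalSpace Z] [ChartedSpace F Z]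

theorem DiffForm.apply_congr₁ (a : DiffForm F Z 1) {x x' : Z} (h : x = x') (v : F) :
    a x ![(v : TangentSpace 𝓘(ℝ, F) x)] = a x' ![(v : TangentSpace 𝓘(ℝ, F) x')] := by
  subst h; rfl

theorem DiffForm.apply_congr₂ (a : DiffForm F Z 2) {x x' : Z} (h : x = x') (v w : F) :
    a x ![(v : TangentSpace 𝓘(ℝ, F) x), (w : TangentSpace 𝓘(ℝ, F) x)] =
      a x' ![(v : TangentSpace 𝓘(ℝ, F) x'), (w : TangentSpace 𝓘(ℝ, F) x')] := by
  subst h; rfl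

theorem DiffForm.inChart_apply₁ (a : DiffForm F Z 1) (φ : OpenPartialHomeomorph Z F) (b : F)
    (v : F) : a.inChart φ b ![v] =
      a (φ.symm b) ![mfderiv 𝓘(ℝ, F) 𝓘(ℝ, F) φ.symm b v] := by
  rw [DiffForm.inChart]
  erw [ContinuousAlternatingMap.compContinuousLinearMap_apply]
  congr 1
  ext i
  fin_cases i
  rfl

theorem DiffForm.inChart_apply₂ (a : DiffForm F Z 2) (φ : OpenPartialHomeomorph Z F) (b : F)
    (v w : F) : a.inChart φ b ![v, w] =
      a (φ.symm b) ![mfderiv 𝓘(ℝ, F) 𝓘(ℝ, F) φ.symm b v,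
        mfderiv 𝓘(ℝ, F) 𝓘(ℝ, F) φ.symm b w] := by
  rw [DiffForm.inChart]
  erw [ContinuousAlternatingMap.compContinuousLinearMap_apply]
  congr 1
  ext i
  fin_cases i <;> rfl

theorem DiffForm.swap (a : DiffForm F Z 2) (x : Z) (v w : TangentSpace 𝓘(ℝ, F) x) :
    a x ![v, w] = -a x ![w, v] := by
  have := (a x).map_swap ![w, v] (i := 0) (j := 1) (by decide)
  refine Eq.trans ?_ this
  refine congrArg (a x) ?_
  ext i
  fin_cases i <;> rfl

theorem DiffForm.add_left (a : DiffForm F Z 2) (x : Z) (v v' w : TangentSpace 𝓘(ℝ, F) x) :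
    a x ![v + v', w] = a x ![v, w] + a x ![v', w] :=
  (a x).vecCons_add ![w] v v'

theorem DiffForm.neg_left (a : DiffForm F Z 2) (x : Z) (v w : TangentSpace 𝓘(ℝ, F) x) :
    a x ![-v, w] = -a x ![v, w] := by
  have := (a x).vecCons_smul ![w] (-1 : ℝ) v
  simpa using this

theorem DiffForm.zero_left (a : DiffForm F Z 2) (x : Z) (w : TangentSpace 𝓘(ℝ, F) x) :
    a x ![0, w] = 0 :=
  (a x).map_coord_zero 0 rfl

theorem DiffForm.zero_apply₁ (a : DiffForm F Z 1) (x : Z) : a x ![0] = 0 :=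
  (a x).map_coord_zero 0 rfl

/-! ### Tube coordinates -/

namespace Tube

variable {S : Set M} (T : Tube E M F Z S)

theorem mdifferentiable :
    T.toHomeo.MDifferentiable 𝓘(ℝ, E) (𝓘(ℝ, ℝ).prod 𝓘(ℝ, F)) :=
  ⟨T.smooth.mdifferentiableOn (by simp), T.smooth_symm.mdifferentiableOn (by simp)⟩

theorem contMDiffOn_z : ContMDiffOn 𝓘(ℝ, E) 𝓘(ℝ, ℝ) ∞ T.z T.toHomeo.source :=
  contMDiff_fst.comp_contMDiffOn T.smooth

theorem contMDiffOn_proj : ContMDiffOn 𝓘(ℝ, E) 𝓘(ℝ, F) ∞ T.proj T.toHomeo.source :=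
  contMDiff_snd.comp_contMDiffOn T.smooth

theorem mdifferentiableAt_z {p : M} (hp : p ∈ T.toHomeo.source) :
    MDifferentiableAt 𝓘(ℝ, E) 𝓘(ℝ, ℝ) T.z p :=
  (T.contMDiffOn_z.contMDiffAt (T.toHomeo.open_source.mem_nhds hp)).mdifferentiableAt (by simp)

theorem mdifferentiableAt_proj {p : M} (hp : p ∈ T.toHomeo.source) :
    MDifferentiableAt 𝓘(ℝ, E) 𝓘(ℝ, F) T.proj p :=
  (T.contMDiffOn_proj.contMDiffAt (T.toHomeo.open_source.mem_nhds hp)).mdifferentiableAt (by simp)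

/-- `lift a Y` is `a ∂_z + Y` in the coordinates `(z, π)`. -/
theorem mfderiv_toHomeo_lift (a : ℝ → ℝ) (Y : VField F Z) {p : M} (hp : p ∈ T.toHomeo.source) :
    mfderiv 𝓘(ℝ, E) (𝓘(ℝ, ℝ).prod 𝓘(ℝ, F)) T.toHomeo p (T.lift a Y p) =
      ((a (T.z p), Y (T.proj p)) : ℝ × TangentSpace 𝓘(ℝ, F) (T.proj p)) := by
  obtain ⟨v, hv⟩ := T.mdifferentiable.mfderiv_surjective hp
    ((a (T.z p), Y (T.proj p)) : ℝ × TangentSpace 𝓘(ℝ, F) (T.proj p))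
  have h := DFunLike.congr_fun (T.mdifferentiable.symm_comp_deriv hp) v
  have hl : T.lift a Y p = v := by
    rw [lift]
    exact (congrArg _ hv.symm).trans h
  rw [hl]
  exact hv

theorem dz_lift (a : ℝ → ℝ) (Y : VField F Z) {p : M} (hp : p ∈ T.toHomeo.source) :
    T.dz p (T.lift a Y p) = a (T.z p) := by
  have h : T.dz p = (mfderiv (𝓘(ℝ, ℝ).prod 𝓘(ℝ, F)) 𝓘(ℝ, ℝ) Prod.fst (T.toHomeo p)).comp
      (mfderiv 𝓘(ℝ, E) (𝓘(ℝ, ℝ).prod 𝓘(ℝ, F)) T.toHomeo p) :=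
    mfderiv_comp p mdifferentiableAt_fst (T.mdifferentiable.mdifferentiableAt hp)
  rw [h, mfderiv_fst]
  exact congrArg Prod.fst (T.mfderiv_toHomeo_lift a Y hp)

theorem dproj_lift (a : ℝ → ℝ) (Y : VField F Z) {p : M} (hp : p ∈ T.toHomeo.source) :
    T.dproj p (T.lift a Y p) = Y (T.proj p) := by
  have h : T.dproj p = (mfderiv (𝓘(ℝ, ℝ).prod 𝓘(ℝ, F)) 𝓘(ℝ, F) Prod.snd (T.toHomeo p)).comp
      (mfderiv 𝓘(ℝ, E) (𝓘(ℝ, ℝ).prod 𝓘(ℝ, F)) T.toHomeo p) :=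
    mfderiv_comp p mdifferentiableAt_snd (T.mdifferentiable.mdifferentiableAt hp)
  rw [h, mfderiv_snd]
  exact congrArg Prod.snd (T.mfderiv_toHomeo_lift a Y hp)

/-! ### Product charts of the tube -/

section Chart

variable (φ : OpenPartialHomeomorph Z F) (L : (ℝ × F) ≃L[ℝ] E)

/-- The chart `p ↦ L (z(p), φ(π(p)))` of `M` built from a chart `φ` of the hypersurface. The
linear isomorphism `L` is there because `M` is modelled on `E` rather than on `ℝ × F`. -/
def chart : OpenPartialHomeomorph M E :=
  T.toHomeo.trans (((OpenPartialHomeomorph.refl ℝ).prod φ).trans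
    L.toHomeomorph.toOpenPartialHomeomorph)

theorem chart_symm_apply (y : E) :
    (T.chart φ L).symm y = T.toHomeo.symm ((L.symm y).1, φ.symm (L.symm y).2) := rfl

theorem mem_chart_source {p : M} :
    p ∈ (T.chart φ L).source ↔ p ∈ T.toHomeo.source ∧ T.proj p ∈ φ.source := by
  simp [chart, proj]

theorem mem_chart_target {y : E} :
    y ∈ (T.chart φ L).target ↔ (L.symm y).1 ∈ Ioo (-T.ε) T.ε ∧ (L.symm y).2 ∈ φ.target := by
  simp [chart, T.target_eq]
  tauto

variable {φ L}

theorem toHomeo_chart_symm {y : E} (hy : y ∈ (T.chart φ L).target) :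
    T.toHomeo ((T.chart φ L).symm y) = ((L.symm y).1, φ.symm (L.symm y).2) := by
  rw [chart_symm_apply]
  apply T.toHomeo.right_inv
  rw [T.target_eq]
  exact ⟨((T.mem_chart_target φ L).1 hy).1, mem_univ _⟩

theorem z_chart_symm {y : E} (hy : y ∈ (T.chart φ L).target) :
    T.z ((T.chart φ L).symm y) = (L.symm y).1 :=
  congrArg Prod.fst (T.toHomeo_chart_symm hy)

theorem proj_chart_symm {y : E} (hy : y ∈ (T.chart φ L).target) :
    T.proj ((T.chart φ L).symm y) = φ.symm (L.symm y).2 :=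
  congrArg Prod.snd (T.toHomeo_chart_symm hy)

theorem chart_symm_mem_source {y : E} (hy : y ∈ (T.chart φ L).target) :
    (T.chart φ L).symm y ∈ T.toHomeo.source :=
  ((T.mem_chart_source φ L).1 ((T.chart φ L).map_target hy)).1

theorem chart_symm_mem_punctured {y : E} (hy : y ∈ (T.chart φ L).target) (h : (L.symm y).1 ≠ 0) :
    (T.chart φ L).symm y ∈ T.punctured := by
  have hs := T.chart_symm_mem_source hy
  refine ⟨hs, fun hS => h ?_⟩
  rw [← T.z_chart_symm hy]
  exact (T.mem_iff _ hs).1 hS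

theorem mfderiv_chart (hφ : φ ∈ IsManifold.maximalAtlas 𝓘(ℝ, F) ∞ Z) {p : M}
    (hp : p ∈ (T.chart φ L).source) (v : TangentSpace 𝓘(ℝ, E) p) :
    mfderiv 𝓘(ℝ, E) 𝓘(ℝ, E) (T.chart φ L) p v =
      L (T.dz p v, mfderiv 𝓘(ℝ, F) 𝓘(ℝ, F) φ (T.proj p) (T.dproj p v)) := by
  obtain ⟨hp1, hp2⟩ := (T.mem_chart_source φ L).1 hp
  have h1 := (T.mdifferentiableAt_z hp1).hasMFDerivAt
  have h2 := (T.mdifferentiableAt_proj hp1).hasMFDerivAt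
  have h3 := ((contMDiffAt_of_mem_maximalAtlas hφ hp2).mdifferentiableAt
    (by simp)).hasMFDerivAt
  have h4 : HasMFDerivAt 𝓘(ℝ, E) 𝓘(ℝ, ℝ × F) (fun q => (T.z q, φ (T.proj q))) p
      ((T.dz p).prod ((mfderiv 𝓘(ℝ, F) 𝓘(ℝ, F) φ (T.proj p)).comp (T.dproj p))) := by
    rw [modelWithCornersSelf_prod, ← chartedSpaceSelf_prod]
    exact h1.prodMk (h3.comp p h2)
  have h5 := (L : ℝ × F →L[ℝ] E).hasFDerivAt.hasMFDerivAt.comp p h4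
  exact congrArg (fun A : E →L[ℝ] E => A v) h5.mfderiv

variable (hφ : φ ∈ IsManifold.maximalAtlas 𝓘(ℝ, F) ∞ Z)
include hφ

theorem chart_mem_maximalAtlas [IsManifold 𝓘(ℝ, E) ∞ M] :
    T.chart φ L ∈ IsManifold.maximalAtlas 𝓘(ℝ, E) ∞ M := by
  refine (IsManifold.mem_maximalAtlas_iff_contMDiffOn (I := 𝓘(ℝ, E)) (n := ∞) _).2 ⟨?_, ?_⟩
  · have h1 : ContMDiffOn 𝓘(ℝ, E) 𝓘(ℝ, ℝ) ∞ T.z (T.chart φ L).source :=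
      T.contMDiffOn_z.mono fun p hp => ((T.mem_chart_source φ L).1 hp).1
    have h2 : ContMDiffOn 𝓘(ℝ, E) 𝓘(ℝ, F) ∞ (φ ∘ T.proj) (T.chart φ L).source :=
      (contMDiffOn_of_mem_maximalAtlas hφ).comp
        (T.contMDiffOn_proj.mono fun p hp => ((T.mem_chart_source φ L).1 hp).1)
        fun p hp => ((T.mem_chart_source φ L).1 hp).2
    exact L.contDiff.contMDiff.comp_contMDiffOn (h1.prodMk_space h2)
  · have h1 : ContMDiff 𝓘(ℝ, E) 𝓘(ℝ, ℝ) ∞ (fun y => (L.symm y).1) :=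
      (contDiff_fst.comp L.symm.contDiff).contMDiff
    have h2 : ContMDiff 𝓘(ℝ, E) 𝓘(ℝ, F) ∞ (fun y => (L.symm y).2) :=
      (contDiff_snd.comp L.symm.contDiff).contMDiff
    have h3 : ContMDiffOn 𝓘(ℝ, E) 𝓘(ℝ, F) ∞ (fun y => φ.symm (L.symm y).2)
        (T.chart φ L).target :=
      (contMDiffOn_symm_of_mem_maximalAtlas hφ).comp h2.contMDiffOn
        fun y hy => ((T.mem_chart_target φ L).1 hy).2
    refine T.smooth_symm.comp (h1.contMDiffOn.prodMk h3) fun y hy => ?_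
    have : ((L.symm y).1, φ.symm (L.symm y).2) ∈ T.toHomeo.target := by
      rw [T.target_eq]
      exact ⟨((T.mem_chart_target φ L).1 hy).1, mem_univ _⟩
    exact this

theorem mdifferentiableAt_chart_symm [IsManifold 𝓘(ℝ, E) ∞ M] {y : E}
    (hy : y ∈ (T.chart φ L).target) :
    MDifferentiableAt 𝓘(ℝ, E) 𝓘(ℝ, E) (T.chart φ L).symm y :=
  (contMDiffAt_symm_of_mem_maximalAtlas (T.chart_mem_maximalAtlas hφ) hy).mdifferentiableAt
    (by simp)

theorem dz_mfderiv_chart_symm [IsManifold 𝓘(ℝ, E) ∞ M] {y : E}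
    (hy : y ∈ (T.chart φ L).target) (v : E) :
    T.dz ((T.chart φ L).symm y) (mfderiv 𝓘(ℝ, E) 𝓘(ℝ, E) (T.chart φ L).symm y v) =
      (L.symm v).1 := by
  have h := mfderiv_comp y (T.mdifferentiableAt_z (T.chart_symm_mem_source hy))
    (T.mdifferentiableAt_chart_symm hφ hy)
  have h' : T.z ∘ (T.chart φ L).symm =ᶠ[𝓝 y] fun y => (L.symm y).1 := by
    filter_upwards [(T.chart φ L).open_target.mem_nhds hy] with y' hy'
    exact T.z_chart_symm hy'
  have h2 : mfderiv 𝓘(ℝ, E) 𝓘(ℝ, ℝ) (T.z ∘ (T.chart φ L).symm) y v = (L.symm v).1 := by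
    rw [h'.mfderiv_eq, mfderiv_eq_fderiv]
    exact congrArg (fun A : E →L[ℝ] ℝ => A v)
      ((ContinuousLinearMap.fst ℝ ℝ F).comp (L.symm : E →L[ℝ] ℝ × F)).fderiv
  rw [← h2, h]
  rfl

theorem dproj_mfderiv_chart_symm [IsManifold 𝓘(ℝ, E) ∞ M] {y : E}
    (hy : y ∈ (T.chart φ L).target) (v : E) :
    (T.dproj ((T.chart φ L).symm y)
      (mfderiv 𝓘(ℝ, E) 𝓘(ℝ, E) (T.chart φ L).symm y v) : F) =
      mfderiv 𝓘(ℝ, F) 𝓘(ℝ, F) φ.symm (L.symm y).2 (L.symm v).2 := by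
  have h := mfderiv_comp y (T.mdifferentiableAt_proj (T.chart_symm_mem_source hy))
    (T.mdifferentiableAt_chart_symm hφ hy)
  have h' : T.proj ∘ (T.chart φ L).symm =ᶠ[𝓝 y] φ.symm ∘ fun y => (L.symm y).2 := by
    filter_upwards [(T.chart φ L).open_target.mem_nhds hy] with y' hy'
    exact T.proj_chart_symm hy'
  have hl : HasFDerivAt (fun y => (L.symm y).2)
      ((ContinuousLinearMap.snd ℝ ℝ F).comp (L.symm : E →L[ℝ] ℝ × F)) y :=
    ((ContinuousLinearMap.snd ℝ ℝ F).comp (L.symm : E →L[ℝ] ℝ × F)).hasFDerivAt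
  have h3 := mfderiv_comp y
    ((contMDiffAt_symm_of_mem_maximalAtlas hφ ((T.mem_chart_target φ L).1 hy).2).mdifferentiableAt
      (by simp)) hl.hasMFDerivAt.mdifferentiableAt
  rw [hl.hasMFDerivAt.mfderiv] at h3
  have h4 := (h.symm.trans h'.mfderiv_eq).trans h3
  exact congrArg (fun A : E →L[ℝ] F => A v) h4

end Chart

end Tube

/-! ### The normal form of the `b^m`-symplectic form -/

/-- The coefficients of a polynomial that vanishes on an interval are zero. -/
theorem eq_zero_of_sum_mul_pow_sub_eq_zero {m : ℕ} {c : ℕ → ℝ} {ε : ℝ} (hε : 0 < ε)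
    (h : ∀ r ∈ Ioo 0 ε, ∑ i ∈ Finset.Icc 1 m, c i * r ^ (m - i) = 0) {i : ℕ}
    (hi : i ∈ Finset.Icc 1 m) : c i = 0 := by
  classical
  set P : Polynomial ℝ := ∑ i ∈ Finset.Icc 1 m, Polynomial.C (c i) * Polynomial.X ^ (m - i) with hP
  have hP0 : P = 0 := by
    refine Polynomial.eq_zero_of_infinite_isRoot P ((Ioo_infinite hε).mono fun r hr => ?_)
    have := h r hr
    simpa [Polynomial.IsRoot, hP, Polynomial.eval_finsetSum] using this
  have hcoeff : P.coeff (m - i) = c i := by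
    rw [hP, Polynomial.finsetSum_coeff, Finset.sum_eq_single i]
    · simp
    · intro j hj hji
      rw [Finset.mem_Icc] at hi hj
      rw [Polynomial.coeff_C_mul_X_pow, if_neg (by omega)]
    · exact fun h => absurd hi h
  rw [← hcoeff, hP0, Polynomial.coeff_zero]

namespace Tube

variable {S : Set M} {T : Tube E M F Z S} {m : ℕ} {om : DiffForm E M 2}
  {α : ℕ → DiffForm F Z 1} {β : DiffForm F Z 2}
  {φ : OpenPartialHomeomorph Z F} {L : (ℝ × F) ≃L[ℝ] E}

theorem z_ne_zero {p : M} (hp : p ∈ T.punctured) : T.z p ≠ 0 :=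
  fun h => hp.2 ((T.mem_iff p hp.1).2 h)

theorem normalField_inChart (hφ : φ ∈ IsManifold.maximalAtlas 𝓘(ℝ, F) ∞ Z) {y : E}
    (hy : y ∈ (T.chart φ L).target) :
    (T.normalField m).inChart (T.chart φ L) y = L ((L.symm y).1 ^ m, 0) := by
  have hs := T.chart_symm_mem_source hy
  rw [VField.inChart, T.mfderiv_chart hφ ((T.chart φ L).map_target hy), normalField,
    T.dz_lift _ _ hs, T.dproj_lift _ _ hs, T.z_chart_symm hy, map_zero]
  rfl

variable [IsManifold 𝓘(ℝ, E) ∞ M]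

/-- The Laurent expansion of `om` in the chart `Tube.chart`, whose coordinates `L.symm y` are
`(z, x)` with `x` the coordinates of the chart `φ` of the hypersurface. -/
theorem IsAdapted.inChart_apply (hT : T.IsAdapted m om α β)
    (hφ : φ ∈ IsManifold.maximalAtlas 𝓘(ℝ, F) ∞ Z) {y : E} (hy : y ∈ (T.chart φ L).target)
    (hy0 : (L.symm y).1 ≠ 0) (v w : E) :
    om.inChart (T.chart φ L) y ![v, w] =
      ∑ i ∈ Finset.Icc 1 m, ((L.symm y).1 ^ i)⁻¹ *
        ((L.symm v).1 * (α i).inChart φ (L.symm y).2 ![(L.symm w).2] -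
          (L.symm w).1 * (α i).inChart φ (L.symm y).2 ![(L.symm v).2]) +
      β.inChart φ (L.symm y).2 ![(L.symm v).2, (L.symm w).2] := by
  have hα : ∀ i (v : E), α i (T.proj ((T.chart φ L).symm y))
      ![T.dproj ((T.chart φ L).symm y) (mfderiv 𝓘(ℝ, E) 𝓘(ℝ, E) (T.chart φ L).symm y v)] =
      (α i).inChart φ (L.symm y).2 ![(L.symm v).2] := by
    intro i v
    rw [DiffForm.inChart_apply₁, ← T.dproj_mfderiv_chart_symm hφ hy v]
    exact DiffForm.apply_congr₁ _ (T.proj_chart_symm hy) _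
  have hβ : β (T.proj ((T.chart φ L).symm y))
      ![T.dproj ((T.chart φ L).symm y) (mfderiv 𝓘(ℝ, E) 𝓘(ℝ, E) (T.chart φ L).symm y v),
        T.dproj ((T.chart φ L).symm y) (mfderiv 𝓘(ℝ, E) 𝓘(ℝ, E) (T.chart φ L).symm y w)] =
      β.inChart φ (L.symm y).2 ![(L.symm v).2, (L.symm w).2] := by
    rw [DiffForm.inChart_apply₂, ← T.dproj_mfderiv_chart_symm hφ hy v,
      ← T.dproj_mfderiv_chart_symm hφ hy w]
    exact DiffForm.apply_congr₂ _ (T.proj_chart_symm hy) _ _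
  rw [DiffForm.inChart_apply₂, hT.laurent _ (T.chart_symm_mem_punctured hy hy0)]
  refine congrArg₂ (· + ·) (Finset.sum_congr rfl fun i _ => ?_) hβ
  rw [T.z_chart_symm hy, T.dz_mfderiv_chart_symm hφ hy, T.dz_mfderiv_chart_symm hφ hy, hα, hα]

/-- The Lie derivative along `X^σ = z ^ m ∂_z`, evaluated on `∂_z` and on a vector `w` tangent to
the slices of the tube, is `∑ i, (m - i) z ^ (m - 1 - i) α_i(w)`. The sum below is `z` times this,
so that all exponents are natural numbers without truncation. -/
theorem IsAdapted.sum_eq_zero (hT : T.IsAdapted m om α β)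
    (hom : IsBmSymplectic m om S)
    (hφ : φ ∈ IsManifold.maximalAtlas 𝓘(ℝ, F) ∞ Z) {b : F} (hb : b ∈ φ.target) {r : ℝ}
    (hr : r ∈ Ioo 0 T.ε) (w : F) (L : (ℝ × F) ≃L[ℝ] E) :
    ∑ i ∈ Finset.Icc 1 m, (((m : ℝ) - i) * (α i).inChart φ b ![w]) * r ^ (m - i) = 0 := by
  set e := T.chart φ L with he
  have hemem : e ∈ IsManifold.maximalAtlas 𝓘(ℝ, E) ∞ M := T.chart_mem_maximalAtlas hφ
  have hr0 : r ≠ 0 := hr.1.ne'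
  set y : E := L (r, b) with hydef
  have hLy : L.symm y = (r, b) := L.symm_apply_apply _
  have hy : y ∈ e.target := by
    rw [he, T.mem_chart_target, hLy]
    exact ⟨⟨by linarith [hr.1, T.ε_pos], hr.2⟩, hb⟩
  have hyp : e.symm y ∈ T.punctured := T.chart_symm_mem_punctured hy (by rw [hLy]; exact hr0)
  set a : ℕ → ℝ := fun i => (α i).inChart φ b ![w] with ha
  set V : Fin 2 → E := ![L (1, 0), L (0, w)] with hV
  have hlie := hT.symplectic.lie_eq_zero e hemem y hy hyp V
  -- the derivative of the vector field
  have hX : (T.normalField m).inChart e =ᶠ[𝓝 y] fun y => L ((L.symm y).1 ^ m, 0) := by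
    filter_upwards [e.open_target.mem_nhds hy] with y' hy' using normalField_inChart hφ hy'
  have hXy : (T.normalField m).inChart e y = r ^ m • L (1, 0) := by
    refine hX.self_of_nhds.trans ?_
    rw [← map_smul]
    simp [hLy]
  have hDX : ∀ v, fderiv ℝ ((T.normalField m).inChart e) y v =
      L (m * r ^ (m - 1) * (L.symm v).1, 0) := by
    intro v
    have h1 : HasFDerivAt (fun y => (L.symm y).1)
        ((ContinuousLinearMap.fst ℝ ℝ F).comp (L.symm : E →L[ℝ] ℝ × F)) y :=
      ((ContinuousLinearMap.fst ℝ ℝ F).comp (L.symm : E →L[ℝ] ℝ × F)).hasFDerivAt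
    have h2 := (L : ℝ × F →L[ℝ] E).hasFDerivAt.comp y
      ((h1.pow m).prodMk (hasFDerivAt_const (0 : F) y))
    rw [hX.fderiv_eq]
    refine (congrArg (fun A : E →L[ℝ] E => A v) h2.fderiv).trans ?_
    simp [hLy]
  -- the derivative of the form along the vector field
  have hdiff : DifferentiableAt ℝ (om.inChart e) y := by
    have hopen : IsOpen (e.target ∩ e.symm ⁻¹' Sᶜ) :=
      e.symm.isOpen_inter_preimage hom.isClosed.isOpen_compl
    exact ((hom.smooth e hemem).contDiffAt (hopen.mem_nhds ⟨hy, hyp.2⟩)).differentiableAt (by simp)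
  have hline : HasDerivAt (fun t : ℝ => y + t • L (1, 0)) (L (1, 0)) 0 := by
    simpa using ((hasDerivAt_id (0 : ℝ)).smul_const (L (1, 0))).const_add y
  have hLline : ∀ t : ℝ, L.symm (y + t • L (1, 0)) = (r + t, b) := by
    intro t
    simp [hLy]
  have hD1 : HasDerivAt (fun t : ℝ => om.inChart e (y + t • L (1, 0)) V)
      (fderiv ℝ (om.inChart e) y (L (1, 0)) V) 0 := by
    have h0 : HasFDerivAt (om.inChart e) (fderiv ℝ (om.inChart e) y)
        (y + (0 : ℝ) • L (1, 0)) := by simpa using hdiff.hasFDerivAt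
    have h1 := h0.comp_hasDerivAt (0 : ℝ) hline
    exact (ContinuousAlternatingMap.apply ℝ E ℝ V).hasFDerivAt.comp_hasDerivAt (0 : ℝ) h1
  have hform : ∀ {y' : E} {r' : ℝ}, y' ∈ e.target → L.symm y' = (r', b) → r' ≠ 0 →
      ∀ s : ℝ, om.inChart e y' ![L (s, 0), L (0, w)] =
        ∑ i ∈ Finset.Icc 1 m, (r' ^ i)⁻¹ * (s * a i) := by
    intro y' r' hy' hr' hr'0 s
    rw [he, hT.inChart_apply hφ hy' (by rw [hr']; exact hr'0), hr']
    simp only [ContinuousLinearEquiv.symm_apply_apply, zero_mul, sub_zero]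
    rw [show β.inChart φ b ![0, w] = 0 from (β.inChart φ b).map_coord_zero 0 rfl, add_zero]
  have hD2 : HasDerivAt (fun t : ℝ => ∑ i ∈ Finset.Icc 1 m, ((r + t) ^ i)⁻¹ * (1 * a i))
      (∑ i ∈ Finset.Icc 1 m, -(i * r ^ (i - 1)) / (r ^ i) ^ 2 * (1 * a i)) 0 := by
    refine HasDerivAt.fun_sum fun i _ => HasDerivAt.mul_const ?_ _
    have h1 : HasDerivAt (fun t : ℝ => (r + t) ^ i) (i * r ^ (i - 1)) 0 := by
      have := ((hasDerivAt_id (0 : ℝ)).const_add r).fun_pow i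
      simpa using this
    have := h1.fun_inv (by simpa using pow_ne_zero i hr0)
    simpa using this
  have hD : fderiv ℝ (om.inChart e) y (L (1, 0)) V =
      ∑ i ∈ Finset.Icc 1 m, -(i * r ^ (i - 1)) / (r ^ i) ^ 2 * (1 * a i) := by
    refine hD1.unique (hD2.congr_of_eventuallyEq ?_)
    have hc : Continuous (fun t : ℝ => y + t • L (1, 0)) := by fun_prop
    have ht : ∀ᶠ t : ℝ in 𝓝 0, y + t • L (1, 0) ∈ e.target :=
      hc.continuousAt.eventually_mem (e.open_target.mem_nhds (by simpa using hy))
    have ht' : ∀ᶠ t : ℝ in 𝓝 0, r + t ≠ 0 :=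
      ((continuous_const.add continuous_id).continuousAt (x := (0 : ℝ))).eventually_ne
        (by simpa using hr0)
    filter_upwards [ht, ht'] with t h1 h2
    exact hform h1 (hLline t) h2 1
  rw [lieDerivForm, hXy, map_smul, Fin.sum_univ_two, hDX, hDX] at hlie
  have hu0 : Function.update V 0 (L (m * r ^ (m - 1) * (L.symm (V 0)).1, 0)) =
      ![L (m * r ^ (m - 1), 0), L (0, w)] := by
    ext i
    fin_cases i <;> simp [hV]
  have hu1 : om.inChart e y
      (Function.update V 1 (L (m * r ^ (m - 1) * (L.symm (V 1)).1, 0))) = 0 := by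
    refine (om.inChart e y).map_coord_zero 1 ?_
    simp [hV]
  rw [hu0, hu1, hform hy hLy hr0, add_zero] at hlie
  change r ^ m * fderiv ℝ (om.inChart e) y (L (1, 0)) V + _ = 0 at hlie
  rw [hD, Finset.mul_sum, ← Finset.sum_add_distrib] at hlie
  have hfin : ∑ i ∈ Finset.Icc 1 m, (((m : ℝ) - i) * a i) * r ^ (m - i) = r * 0 := by
    rw [← hlie, Finset.mul_sum]
    refine Finset.sum_congr rfl fun i hi => ?_
    obtain ⟨hi1, him⟩ := Finset.mem_Icc.1 hi
    obtain ⟨j, rfl⟩ := Nat.exists_eq_add_of_le' hi1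
    obtain ⟨n, rfl⟩ := Nat.exists_eq_add_of_le' him
    have e1 : n + (j + 1) - (j + 1) = n := by omega
    have e2 : n + (j + 1) - 1 = n + j := by omega
    rw [e1, e2, Nat.add_sub_cancel]
    field_simp
    ring
  rw [hfin, mul_zero]

variable [IsManifold 𝓘(ℝ, F) ∞ Z]

/-- As `X^σ` is a symplectic vector field, the lower order terms of the Laurent expansion
vanish. -/
theorem IsAdapted.form_eq_zero (hT : T.IsAdapted m om α β)
    (hom : IsBmSymplectic m om S) (L : (ℝ × F) ≃L[ℝ] E) {i : ℕ} (hi : i ∈ Finset.Icc 1 m)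
    (him : i ≠ m) (x : Z) (v : TangentSpace 𝓘(ℝ, F) x) : α i x ![v] = 0 := by
  have hφ : chartAt F x ∈ IsManifold.maximalAtlas 𝓘(ℝ, F) ∞ Z :=
    IsManifold.chart_mem_maximalAtlas x
  have hx : x ∈ (chartAt F x).source := ChartedSpace.mem_chart_source x
  have h := eq_zero_of_sum_mul_pow_sub_eq_zero T.ε_pos (fun r hr => hT.sum_eq_zero hom hφ
    ((chartAt F x).map_source hx) hr (mfderiv 𝓘(ℝ, F) 𝓘(ℝ, F) (chartAt F x) x v) L) hi
  have h1 : ((m : ℝ) - i) ≠ 0 := sub_ne_zero.2 (by exact_mod_cast him.symm)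
  have h2 := (mul_eq_zero.1 h).resolve_left h1
  replace h2 := ((α i).inChart_apply₁ (chartAt F x) (chartAt F x x)
    (mfderiv 𝓘(ℝ, F) 𝓘(ℝ, F) (chartAt F x) x v)).symm.trans h2
  have h3 : mfderiv 𝓘(ℝ, F) 𝓘(ℝ, F) (chartAt F x).symm (chartAt F x x)
      (mfderiv 𝓘(ℝ, F) 𝓘(ℝ, F) (chartAt F x) x v) = v :=
    DFunLike.congr_fun ((mdifferentiable_chart (I := 𝓘(ℝ, F)) x).symm_comp_deriv hx) v
  rw [← h2]
  refine (DiffForm.apply_congr₁ (α i) ((chartAt F x).left_inv hx).symm v).trans ?_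
  exact congrArg (fun w => α i _ ![w]) h3.symm

/-- `om = z ^ (-m) dz ∧ π^*α_m + π^*β`. -/
theorem IsAdapted.apply_eq (hT : T.IsAdapted m om α β) (hm : 1 ≤ m)
    (hom : IsBmSymplectic m om S) {p : M} (hp : p ∈ T.punctured) (v w : TangentSpace 𝓘(ℝ, E) p) :
    om p ![v, w] = (T.z p ^ m)⁻¹ *
        (T.dz p v * α m (T.proj p) ![T.dproj p w] - T.dz p w * α m (T.proj p) ![T.dproj p v])
      + β (T.proj p) ![T.dproj p v, T.dproj p w] := by
  -- the linear isomorphism of the models is the differential of the tube coordinates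
  have L : (ℝ × F) ≃L[ℝ] E := (T.mdifferentiable.mfderiv hp.1).symm
  rw [hT.laurent p hp, Finset.sum_eq_single m]
  · intro i hi him
    rw [hT.form_eq_zero hom L hi him, hT.form_eq_zero hom L hi him]
    simp
  · intro h
    exact absurd (Finset.mem_Icc.2 ⟨hm, le_rfl⟩) h

/-- `ι_{X^σ} om = π^*α_m`. -/
theorem IsAdapted.normalField_apply (hT : T.IsAdapted m om α β) (hm : 1 ≤ m)
    (hom : IsBmSymplectic m om S) {p : M} (hp : p ∈ T.punctured) (v : TangentSpace 𝓘(ℝ, E) p) :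
    om p ![T.normalField m p, v] = α m (T.proj p) ![T.dproj p v] := by
  rw [hT.apply_eq hm hom hp, normalField, T.dz_lift _ _ hp.1, T.dproj_lift _ _ hp.1]
  rw [DiffForm.zero_left, DiffForm.zero_apply₁, mul_zero, sub_zero, add_zero, ← mul_assoc,
    inv_mul_cancel₀ (pow_ne_zero m (z_ne_zero hp)), one_mul]

/-- `ι_R om = - z ^ (-m) dz = - df`. -/
theorem IsAdapted.apply_extend (hT : T.IsAdapted m om α β) (hm : 1 ≤ m)
    (hom : IsBmSymplectic m om S) {R : VField F Z} (hR : IsReeb (α m) β R) {p : M}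
    (hp : p ∈ T.punctured) (v : TangentSpace 𝓘(ℝ, E) p) :
    om p ![v, T.extend R p] = (T.z p ^ m)⁻¹ * T.dz p v := by
  rw [hT.apply_eq hm hom hp, extend, T.dz_lift _ _ hp.1, T.dproj_lift _ _ hp.1, (hR _).1,
    DiffForm.swap, (hR _).2]
  ring

end Tube

/-! ### Pullbacks of closed 1-forms, and the primitive of `z ^ (-m)` -/

/-- If `a` is a closed 1-form and `v` is a smooth map from the plane, then
`∂_s (a(∂_t v)) = ∂_t (a(∂_s v))`, i.e. the pullback `v^*a` is closed. -/
theorem DiffForm.fderiv_pullback_symm [IsManifold 𝓘(ℝ, F) ∞ Z] {a : DiffForm F Z 1}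
    (ha : a.SmoothOn univ) (hac : a.ClosedOn univ) {Ω : Set ℂ} (hΩ : IsOpen Ω) {v : ℂ → Z}
    (hv : ContMDiffOn 𝓘(ℝ, ℂ) 𝓘(ℝ, F) ∞ v Ω) {η₀ : ℂ} (hη₀ : η₀ ∈ Ω) :
    (∀ c : ℂ, DifferentiableAt ℝ (fun η => a (v η) ![mfderiv 𝓘(ℝ, ℂ) 𝓘(ℝ, F) v η c]) η₀) ∧
    fderiv ℝ (fun η => a (v η) ![mfderiv 𝓘(ℝ, ℂ) 𝓘(ℝ, F) v η Complex.I]) η₀ 1 =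
      fderiv ℝ (fun η => a (v η) ![mfderiv 𝓘(ℝ, ℂ) 𝓘(ℝ, F) v η (1 : ℂ)]) η₀ Complex.I := by
  set φ := chartAt F (v η₀) with hφdef
  have hφ : φ ∈ IsManifold.maximalAtlas 𝓘(ℝ, F) ∞ Z := IsManifold.chart_mem_maximalAtlas _
  have hsrc : v η₀ ∈ φ.source := ChartedSpace.mem_chart_source _
  have hvat : ∀ η ∈ Ω, ContMDiffAt 𝓘(ℝ, ℂ) 𝓘(ℝ, F) ∞ v η := fun η hη =>
    hv.contMDiffAt (hΩ.mem_nhds hη)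
  set W : ℂ → F := φ ∘ v with hW
  have hWat : ∀ η ∈ Ω, v η ∈ φ.source → ContDiffAt ℝ ∞ W η := fun η hη hs =>
    ((contMDiffAt_of_mem_maximalAtlas hφ hs).comp η (hvat η hη)).contDiffAt
  have hW₀ := hWat η₀ hη₀ hsrc
  set A : F → F [⋀^Fin 1]→L[ℝ] ℝ := a.inChart φ with hA
  have hWt : W η₀ ∈ φ.target := φ.map_source hsrc
  have hAd : DifferentiableAt ℝ A (W η₀) := by
    have h1 := ha φ hφ
    rw [preimage_univ, inter_univ] at h1
    exact (h1.contDiffAt (φ.open_target.mem_nhds hWt)).differentiableAt (by simp)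
  set pb : ℂ → ℂ [⋀^Fin 1]→L[ℝ] ℝ :=
    fun η => (A (W η)).compContinuousLinearMap (fderiv ℝ W η) with hpb
  have hext : extDeriv pb η₀ = 0 := by
    rw [hpb, extDeriv_pullback (r := ∞) hAd hW₀ (by simpa using ENat.LEInfty.out),
      hac φ hφ _ hWt (mem_univ _)]
    ext; simp
  have hpbd : DifferentiableAt ℝ pb η₀ := by
    have h1 : DifferentiableAt ℝ (fun η => A (W η)) η₀ :=
      hAd.comp η₀ (hW₀.differentiableAt (by simp))
    have h2 : DifferentiableAt ℝ (fderiv ℝ W) η₀ :=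
      (hW₀.fderiv_right (m := 1) (by norm_cast)).differentiableAt (by simp)
    exact h1.continuousAlternatingMapCompContinuousLinearMap h2
  have hlocal : ∀ c : ℂ, (fun η => a (v η) ![mfderiv 𝓘(ℝ, ℂ) 𝓘(ℝ, F) v η c]) =ᶠ[𝓝 η₀]
      fun η => pb η ![c] := by
    intro c
    have hcont : ContinuousAt v η₀ := (hvat η₀ hη₀).continuousAt
    filter_upwards [hΩ.mem_nhds hη₀, hcont.eventually_mem (φ.open_source.mem_nhds hsrc)]
      with η hη hs
    have e1 : pb η ![c] = A (W η) ![fderiv ℝ W η c] := by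
      rw [hpb, ContinuousAlternatingMap.compContinuousLinearMap_apply]
      congr 1
      ext i
      fin_cases i
      rfl
    have e2 : fderiv ℝ W η = (mfderiv 𝓘(ℝ, F) 𝓘(ℝ, F) φ (v η)).comp
        (mfderiv 𝓘(ℝ, ℂ) 𝓘(ℝ, F) v η) := by
      rw [← mfderiv_eq_fderiv]
      exact mfderiv_comp η
        ((contMDiffAt_of_mem_maximalAtlas hφ hs).mdifferentiableAt (by simp))
        ((hvat η hη).mdifferentiableAt (by simp))
    have e3 : mfderiv 𝓘(ℝ, F) 𝓘(ℝ, F) φ.symm (φ (v η)) (mfderiv 𝓘(ℝ, F) 𝓘(ℝ, F) φ (v η)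
        (mfderiv 𝓘(ℝ, ℂ) 𝓘(ℝ, F) v η c)) = mfderiv 𝓘(ℝ, ℂ) 𝓘(ℝ, F) v η c :=
      DFunLike.congr_fun ((mdifferentiable_chart (I := 𝓘(ℝ, F)) (v η₀)).symm_comp_deriv hs) _
    rw [e1, hA, e2]
    refine Eq.trans ?_ (a.inChart_apply₁ φ _ _).symm
    refine (DiffForm.apply_congr₁ a (φ.left_inv hs).symm _).trans ?_
    exact congrArg (fun w => a _ ![w]) e3.symm
  have hpbapp : ∀ w : Fin 1 → ℂ, DifferentiableAt ℝ (fun η => pb η w) η₀ := fun w =>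
    (ContinuousAlternatingMap.apply ℝ ℂ ℝ w).differentiableAt.comp η₀ hpbd
  refine ⟨fun c => (hlocal c).differentiableAt_iff.2 (hpbapp _), ?_⟩
  rw [(hlocal _).fderiv_eq, (hlocal _).fderiv_eq]
  have h := extDeriv_apply hpbd ![1, Complex.I]
  rw [hext, Fin.sum_univ_two] at h
  have r0 : (0 : Fin 2).removeNth ![(1 : ℂ), Complex.I] = ![Complex.I] := by
    ext i; fin_cases i; rfl
  have r1 : (1 : Fin 2).removeNth ![(1 : ℂ), Complex.I] = ![1] := by
    ext i; fin_cases i; rfl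
  rw [r0, r1] at h
  simp at h
  linarith

/-- The function of `z` underlying `Tube.f`, a primitive of `z ^ (-m)`. For `m = 1` the absolute
value is left out, as `Real.log r = log |r|`. -/
noncomputable def primitive (m : ℕ) (r : ℝ) : ℝ :=
  if m = 1 then Real.log r else -(1 / (((m : ℝ) - 1) * r ^ (m - 1)))

theorem hasDerivAt_primitive {m : ℕ} (hm : 1 ≤ m) {r : ℝ} (hr : r ≠ 0) :
    HasDerivAt (primitive m) (r ^ m)⁻¹ r := by
  by_cases h1 : m = 1
  · subst h1
    have : primitive 1 = Real.log := by funext; simp [primitive]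
    rw [this, pow_one]
    exact Real.hasDerivAt_log hr
  · obtain ⟨n, rfl⟩ : ∃ n, m = n + 2 := ⟨m - 2, by omega⟩
    have hp : primitive (n + 2) = fun r => -(((n : ℝ) + 1)⁻¹ * (r ^ (n + 1))⁻¹) := by
      funext r
      simp only [primitive, h1, if_false]
      push_cast
      rw [one_div, mul_inv, show (n : ℝ) + 2 - 1 = n + 1 by ring]
    rw [hp]
    have h2 := (((hasDerivAt_pow (n + 1) r).fun_inv (pow_ne_zero _ hr)).const_mul
      (((n : ℝ) + 1)⁻¹)).fun_neg
    refine h2.congr_deriv ?_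
    have : (n : ℝ) + 1 ≠ 0 := by positivity
    push_cast
    field_simp
    ring

theorem contDiffAt_primitive (m : ℕ) {r : ℝ} (hr : r ≠ 0) : ContDiffAt ℝ ∞ (primitive m) r := by
  by_cases h1 : m = 1
  · have : primitive m = Real.log := by funext; simp [primitive, h1]
    rw [this]
    exact Real.contDiffAt_log.2 hr
  · have hp : primitive m = fun r => -(((m : ℝ) - 1)⁻¹ * (r ^ (m - 1))⁻¹) := by
      funext r
      simp only [primitive, h1, if_false]
      rw [one_div, mul_inv]
    rw [hp]
    exact (contDiffAt_const.mul ((contDiffAt_id.pow _).inv (pow_ne_zero _ hr))).neg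

/-! ### The Floer equation in the tube -/

namespace Tube

variable {S : Set M} {T : Tube E M F Z S} {m : ℕ} {om : DiffForm E M 2}
  {α : ℕ → DiffForm F Z 1} {β : DiffForm F Z 2} {R : VField F Z} {Ω : Set ℂ}
  {H : ℂ → M → ℝ} {J : ℂ → ∀ p : M, TangentSpace 𝓘(ℝ, E) p →L[ℝ] TangentSpace 𝓘(ℝ, E) p}
  {u : ℂ → M}

theorem f_eq_primitive (m : ℕ) (p : M) : T.f m p = primitive m (T.z p) := by
  rw [f, primitive, Real.log_abs]

theorem contDiffOn_z_comp (hu : ContMDiffOn 𝓘(ℝ, ℂ) 𝓘(ℝ, E) ∞ u Ω)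
    (hmaps : MapsTo u Ω T.punctured) : ContDiffOn ℝ ∞ (T.z ∘ u) Ω :=
  (T.contMDiffOn_z.comp hu fun _ hη => (hmaps hη).1).contDiffOn

theorem contDiffOn_f_comp (hu : ContMDiffOn 𝓘(ℝ, ℂ) 𝓘(ℝ, E) ∞ u Ω)
    (hmaps : MapsTo u Ω T.punctured) : ContDiffOn ℝ ∞ (T.f m ∘ u) Ω := by
  have h : T.f m ∘ u = primitive m ∘ (T.z ∘ u) := by funext; exact f_eq_primitive _ _
  rw [h]
  intro η hη
  exact (contDiffAt_primitive m (z_ne_zero (hmaps hη))).comp_contDiffWithinAt η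
    (contDiffOn_z_comp hu hmaps η hη)

/-- `d(f ∘ u) = z ^ (-m) dz(du)`. -/
theorem fderiv_f_comp (hm : 1 ≤ m) (hΩ : IsOpen Ω) (hu : ContMDiffOn 𝓘(ℝ, ℂ) 𝓘(ℝ, E) ∞ u Ω)
    (hmaps : MapsTo u Ω T.punctured) {η : ℂ} (hη : η ∈ Ω) (c : ℂ) :
    fderiv ℝ (T.f m ∘ u) η c =
      (T.z (u η) ^ m)⁻¹ * T.dz (u η) (mfderiv 𝓘(ℝ, ℂ) 𝓘(ℝ, E) u η c) := by
  have h : T.f m ∘ u = primitive m ∘ (T.z ∘ u) := by funext; exact f_eq_primitive _ _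
  have h1 : DifferentiableAt ℝ (T.z ∘ u) η :=
    ((contDiffOn_z_comp hu hmaps).contDiffAt (hΩ.mem_nhds hη)).differentiableAt (by simp)
  have h2 : fderiv ℝ (T.z ∘ u) η = (T.dz (u η)).comp (mfderiv 𝓘(ℝ, ℂ) 𝓘(ℝ, E) u η) := by
    rw [← mfderiv_eq_fderiv]
    exact mfderiv_comp η (T.mdifferentiableAt_z (hmaps hη).1)
      ((hu.contMDiffAt (hΩ.mem_nhds hη)).mdifferentiableAt (by simp))
  have h3 : HasDerivAt (primitive m) (T.z (u η) ^ m)⁻¹ ((T.z ∘ u) η) :=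
    hasDerivAt_primitive hm (z_ne_zero (hmaps hη))
  rw [h, (h3.comp_hasFDerivAt η h1.hasFDerivAt).fderiv, h2]
  rfl

/-- If the Hamiltonians do not depend on `s`, then neither do their slopes. -/
theorem partialS_eq_zero (hS : IsClosed S) (hΩ : IsOpen Ω)
    {k : ConnectedComponents Z → ℂ → ℝ} {Rt : VField E M}
    (hH : IsAdmissible (T.normalField m) Rt T.punctured T.component Ω H k)
    (hind : ∀ η ∈ Ω, ∀ η' ∈ Ω, η.im = η'.im → ∀ p ∈ T.punctured, H η p = H η' p) {p : M}
    (hp : p ∈ T.punctured) {η : ℂ} (hη : η ∈ Ω) : partialS (k (T.component p)) η = 0 := by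
  have hopen : IsOpen T.punctured := T.toHomeo.open_source.sdiff hS
  have hslope : ∀ η' ∈ Ω, η.im = η'.im → k (T.component p) η' = k (T.component p) η := by
    intro η' hη' him
    have h : H η' =ᶠ[𝓝 p] H η := by
      filter_upwards [hopen.mem_nhds hp] with q hq using (hind η hη η' hη' him q hq).symm
    rw [← hH.linear η' hη' p hp, ← hH.linear η hη p hp, dirDeriv, dirDeriv, h.mfderiv_eq]
    rfl
  have hd : DifferentiableAt ℝ (k (T.component p)) η :=
    ((hH.k_smooth _).contDiffAt (hΩ.mem_nhds hη)).differentiableAt (by simp)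
  have hline : HasDerivAt (fun t : ℝ => η + (t : ℂ)) 1 0 := by
    simpa using (Complex.ofRealCLM.hasDerivAt (x := 0)).const_add η
  have h0 : HasFDerivAt (k (T.component p)) (fderiv ℝ (k (T.component p)) η)
      (η + ((0 : ℝ) : ℂ)) := by simpa using hd.hasFDerivAt
  have h1 := h0.comp_hasDerivAt (0 : ℝ) hline
  refine h1.unique ((hasDerivAt_const (0 : ℝ) (k (T.component p) η)).congr_of_eventuallyEq ?_)
  have hc : Continuous (fun t : ℝ => η + (t : ℂ)) := by fun_prop
  filter_upwards [hc.continuousAt.eventually_mem (x := (0 : ℝ)) (hΩ.mem_nhds (by simpa using hη))]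
    with t ht
  exact hslope _ ht (by simp)

variable [IsManifold 𝓘(ℝ, E) ∞ M] [IsManifold 𝓘(ℝ, F) ∞ Z]

/-- The two components of the Floer equation in the plane spanned by `X^σ` and `R`:
`∂_s (f ∘ u) = α_m(∂_t u) - dH(X^σ)` and `∂_t (f ∘ u) = - α_m(∂_s u)`. -/
theorem fderiv_f_comp_floer (hT : T.IsAdapted m om α β) (hm : 1 ≤ m)
    (hom : IsBmSymplectic m om S) (hR : IsReeb (α m) β R) (hΩ : IsOpen Ω)
    (hJ : ∀ η ∈ Ω, ∀ p ∈ T.punctured,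
      IsAdaptedACSAt om (T.normalField m) (T.extend R) p (J η p))
    (hu : IsFloerSolution om T.punctured Ω H J u) {η : ℂ} (hη : η ∈ Ω)
    (hHR : dirDeriv (H η) (u η) (T.extend R (u η)) = 0) :
    fderiv ℝ (T.f m ∘ u) η 1 =
        α m (T.proj (u η)) ![T.dproj (u η) (mfderiv 𝓘(ℝ, ℂ) 𝓘(ℝ, E) u η Complex.I)] -
          dirDeriv (H η) (u η) (T.normalField m (u η)) ∧
      fderiv ℝ (T.f m ∘ u) η Complex.I =
        -α m (T.proj (u η)) ![T.dproj (u η) (mfderiv 𝓘(ℝ, ℂ) 𝓘(ℝ, E) u η (1 : ℂ))] := by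
  have hp : u η ∈ T.punctured := hu.mapsTo hη
  obtain ⟨w, hw, hfl⟩ := hu.floer η hη
  have hJη := hJ η hη _ hp
  set us : TangentSpace 𝓘(ℝ, E) (u η) := mfderiv 𝓘(ℝ, ℂ) 𝓘(ℝ, E) u η (1 : ℂ) with hus
  set ut : TangentSpace 𝓘(ℝ, E) (u η) := mfderiv 𝓘(ℝ, ℂ) 𝓘(ℝ, E) u η Complex.I with hut
  -- the Floer equation, solved for `∂_t u`
  have hJus : J η (u η) us = ut - w := by
    rw [eq_neg_of_add_eq_zero_left hfl, map_neg, hJη.sq, neg_neg]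
  have hut' : ut = w + J η (u η) us := by rw [hJus]; abel
  rw [fderiv_f_comp hm hΩ hu.smooth hu.mapsTo hη, fderiv_f_comp hm hΩ hu.smooth hu.mapsTo hη,
    ← hT.apply_extend hm hom hR hp, ← hT.apply_extend hm hom hR hp,
    ← hT.normalField_apply hm hom hp, ← hT.normalField_apply hm hom hp]
  constructor
  · have h1 : om (u η) ![us, T.extend R (u η)] =
        om (u η) ![T.normalField m (u η), J η (u η) us] := by
      rw [← hJη.map_X, ← hJη.invariant, DiffForm.swap, hJη.sq, DiffForm.neg_left, neg_neg]
    have h2 : om (u η) ![T.normalField m (u η), ut] =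
        om (u η) ![T.normalField m (u η), w] +
          om (u η) ![T.normalField m (u η), J η (u η) us] := by
      rw [DiffForm.swap, hut', DiffForm.add_left, DiffForm.swap _ _ w,
        DiffForm.swap _ _ (J η (u η) us)]
      ring
    have h3 := hw (T.normalField m (u η))
    rw [DiffForm.swap] at h3
    rw [h1, h2]
    linarith
  · have h1 := hw (T.extend R (u η))
    rw [hHR] at h1
    have h2 : om (u η) ![ut, T.extend R (u η)] = -om (u η) ![T.normalField m (u η), us] := by
      rw [hut', DiffForm.add_left, h1, ← hJη.map_X, hJη.invariant, DiffForm.swap]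
      ring
    exact h2

/-- `Δ(f ∘ u) = - ∂k/∂s`: the closed form `π^*α_m` drops out when the two equations of
`fderiv_f_comp_floer` are differentiated. -/
theorem laplacian_f_comp (hT : T.IsAdapted m om α β) (hm : 1 ≤ m)
    (hom : IsBmSymplectic m om S) (hR : IsReeb (α m) β R) (hΩ : IsOpen Ω)
    {k : ConnectedComponents Z → ℂ → ℝ}
    (hH : IsAdmissible (T.normalField m) (T.extend R) T.punctured T.component Ω H k)
    (hJ : ∀ η ∈ Ω, ∀ p ∈ T.punctured,
      IsAdaptedACSAt om (T.normalField m) (T.extend R) p (J η p))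
    (hu : IsFloerSolution om T.punctured Ω H J u) {η₀ : ℂ} (hη₀ : η₀ ∈ Ω) :
    Δ (T.f m ∘ u) η₀ = -partialS (k (T.component (u η₀))) η₀ := by
  have hg := contDiffOn_f_comp (m := m) hu.smooth hu.mapsTo
  have hv : ContMDiffOn 𝓘(ℝ, ℂ) 𝓘(ℝ, F) ∞ (T.proj ∘ u) Ω :=
    T.contMDiffOn_proj.comp hu.smooth fun _ hη => (hu.mapsTo hη).1
  have hmm : m ∈ Finset.Icc 1 m := Finset.mem_Icc.2 ⟨hm, le_rfl⟩
  obtain ⟨hθd, hθ⟩ := DiffForm.fderiv_pullback_symm (hT.α_smooth m hmm) (hT.α_closed m hmm) hΩ hv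
    hη₀
  have hdv : ∀ η ∈ Ω, ∀ c : ℂ, mfderiv 𝓘(ℝ, ℂ) 𝓘(ℝ, F) (T.proj ∘ u) η c =
      T.dproj (u η) (mfderiv 𝓘(ℝ, ℂ) 𝓘(ℝ, E) u η c) := by
    intro η hη c
    have := mfderiv_comp η (T.mdifferentiableAt_proj (hu.mapsTo hη).1)
      ((hu.smooth.contMDiffAt (hΩ.mem_nhds hη)).mdifferentiableAt (by simp))
    rw [this]
    rfl
  -- the component of the hypersurface is locally constant along `u`
  obtain ⟨ρ, hρ, hball⟩ := Metric.isOpen_iff.1 hΩ η₀ hη₀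
  have hcomp : ∀ η ∈ ball η₀ ρ, T.component (u η) = T.component (u η₀) := by
    intro η hη
    have hpc : IsPreconnected ((T.proj ∘ u) '' ball η₀ ρ) :=
      (convex_ball η₀ ρ).isPreconnected.image _ (hv.continuousOn.mono hball)
    exact ConnectedComponents.coe_eq_coe'.2
      (hpc.subset_connectedComponent (mem_image_of_mem _ (mem_ball_self hρ))
        (mem_image_of_mem _ hη))
  set κ := k (T.component (u η₀)) with hκ
  have hκd : DifferentiableAt ℝ κ η₀ :=
    ((hH.k_smooth _).contDiffAt (hΩ.mem_nhds hη₀)).differentiableAt (by simp)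
  have h1 : (fun η => fderiv ℝ (T.f m ∘ u) η 1) =ᶠ[𝓝 η₀] fun η =>
      α m ((T.proj ∘ u) η) ![mfderiv 𝓘(ℝ, ℂ) 𝓘(ℝ, F) (T.proj ∘ u) η Complex.I] - κ η := by
    filter_upwards [ball_mem_nhds η₀ hρ] with η hη
    have hηΩ := hball hη
    rw [(fderiv_f_comp_floer hT hm hom hR hΩ hJ hu hηΩ
      (hH.reeb_invariant η hηΩ _ (hu.mapsTo hηΩ))).1, hH.linear η hηΩ _ (hu.mapsTo hηΩ),
      hcomp η hη, hdv η hηΩ]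
    rfl
  have h2 : (fun η => fderiv ℝ (T.f m ∘ u) η Complex.I) =ᶠ[𝓝 η₀] fun η =>
      -α m ((T.proj ∘ u) η) ![mfderiv 𝓘(ℝ, ℂ) 𝓘(ℝ, F) (T.proj ∘ u) η (1 : ℂ)] := by
    filter_upwards [ball_mem_nhds η₀ hρ] with η hη
    have hηΩ := hball hη
    rw [(fderiv_f_comp_floer hT hm hom hR hΩ hJ hu hηΩ
      (hH.reeb_invariant η hηΩ _ (hu.mapsTo hηΩ))).2, hdv η hηΩ]
    rfl
  have hdd : DifferentiableAt ℝ (fderiv ℝ (T.f m ∘ u)) η₀ :=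
    ((hg.contDiffAt (hΩ.mem_nhds hη₀)).fderiv_right (m := 1)
      (by norm_cast)).differentiableAt (by simp)
  have hap : ∀ c d : ℂ, fderiv ℝ (fderiv ℝ (T.f m ∘ u)) η₀ d c =
      fderiv ℝ (fun η => fderiv ℝ (T.f m ∘ u) η c) η₀ d := by
    intro c d
    rw [fderiv_clm_apply hdd (differentiableAt_const c)]
    simp
  rw [laplacian_complex_apply, hap, hap, h1.fderiv_eq, h2.fderiv_eq,
    fderiv_fun_sub (hθd _) hκd, fderiv_fun_neg, partialS]
  simp only [sub_apply, neg_apply]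
  rw [hθ]
  ring

end Tube

end BmSymplectic

theorem theoremC
    {E : Type*} [NormedAddCommGroup E] [NormedSpace ℝ E] [FiniteDimensional ℝ E]
    {M : Type*} [TopologicalSpace M] [ChartedSpace E M] [IsManifold 𝓘(ℝ, E) ∞ M]
    {F : Type*} [NormedAddCommGroup F] [NormedSpace ℝ F] [FiniteDimensional ℝ F]
    {Z : Type*} [TopologicalSpace Z] [ChartedSpace F Z] [IsManifold 𝓘(ℝ, F) ∞ Z]
    (m : ℕ) (hm : 1 ≤ m)
    (S : Set M) (om : BmSymplectic.DiffForm E M 2) (hom : BmSymplectic.IsBmSymplectic m om S)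
    (T : BmSymplectic.Tube E M F Z S)
    (α : ℕ → BmSymplectic.DiffForm F Z 1) (β : BmSymplectic.DiffForm F Z 2)
    (hT : T.IsAdapted m om α β)
    (R : BmSymplectic.VField F Z) (hR : BmSymplectic.IsReeb (α m) β R)
    (Ω : Set ℂ) (hΩ : IsOpen Ω)
    (H : ℂ → M → ℝ) (k : ConnectedComponents Z → ℂ → ℝ)
    (hH : BmSymplectic.IsAdmissible (T.normalField m) (T.extend R) T.punctured T.component Ω H k)
    (J : ℂ → ∀ p : M, TangentSpace 𝓘(ℝ, E) p →L[ℝ] TangentSpace 𝓘(ℝ, E) p)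
    (hJ : ∀ η ∈ Ω, ∀ p ∈ T.punctured,
      BmSymplectic.IsAdaptedACSAt om (T.normalField m) (T.extend R) p (J η p))
    (u : ℂ → M) (hu : BmSymplectic.IsFloerSolution om T.punctured Ω H J u) :
    -- the formula for the Laplacian
    (ContDiffOn ℝ ∞ (T.f m ∘ u) Ω ∧
      ∀ η ∈ Ω, Laplacian.laplacian (T.f m ∘ u) η =
        -BmSymplectic.partialS (k (T.component (u η))) η) ∧
    -- Hamiltonians that do not depend on `s`
    ((∀ η ∈ Ω, ∀ η' ∈ Ω, η.im = η'.im → ∀ p ∈ T.punctured, H η p = H η' p) →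
      InnerProductSpace.HarmonicOnNhd (T.f m ∘ u) Ω ∧
      (IsPreconnected Ω →
        (∃ η₀ ∈ Ω, IsMaxOn (T.f m ∘ u) Ω η₀ ∨ IsMinOn (T.f m ∘ u) Ω η₀) →
        ∀ η ∈ Ω, ∀ η' ∈ Ω, T.f m (u η) = T.f m (u η'))) ∧
    -- Hamiltonians whose slope is nondecreasing in `s`
    ((∀ η ∈ Ω, 0 ≤ BmSymplectic.partialS (k (T.component (u η))) η) →
      IsPreconnected Ω →
        (∃ η₀ ∈ Ω, IsMinOn (T.f m ∘ u) Ω η₀) →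
        ∀ η ∈ Ω, ∀ η' ∈ Ω, T.f m (u η) = T.f m (u η')) := by
  have hg := BmSymplectic.Tube.contDiffOn_f_comp (m := m) hu.smooth hu.mapsTo
  have hg2 : ContDiffOn ℝ 2 (T.f m ∘ u) Ω := hg.of_le ENat.LEInfty.out
  have hlap : ∀ η ∈ Ω, Laplacian.laplacian (T.f m ∘ u) η =
      -BmSymplectic.partialS (k (T.component (u η))) η := fun η hη =>
    BmSymplectic.Tube.laplacian_f_comp hT hm hom hR hΩ hH hJ hu hη
  have hneg : ∀ η, Laplacian.laplacian (-(T.f m ∘ u)) η = -Laplacian.laplacian (T.f m ∘ u) η :=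
    fun η => by rw [InnerProductSpace.laplacian_neg]; rfl
  have hmin : (∀ η ∈ Ω, 0 ≤ BmSymplectic.partialS (k (T.component (u η))) η) →
      IsPreconnected Ω → ∀ η₀ ∈ Ω, IsMinOn (T.f m ∘ u) Ω η₀ →
        ∀ η ∈ Ω, T.f m (u η) = T.f m (u η₀) := by
    intro hk hconn η₀ hη₀ hη₀min η hη
    refine neg_injective (BmSymplectic.eq_of_subharmonic_of_isMaxOn hΩ hg2.neg
      (fun η hη => ?_) hconn hη₀ hη₀min.neg η hη)
    refine le_of_le_of_eq ?_ (hneg η).symm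
    rw [hlap η hη, neg_neg]
    exact hk η hη
  refine ⟨⟨hg, hlap⟩, fun hind => ?_, ?_⟩
  · have hk : ∀ η ∈ Ω, BmSymplectic.partialS (k (T.component (u η))) η = 0 := fun η hη =>
      BmSymplectic.Tube.partialS_eq_zero hom.isClosed hΩ hH hind (hu.mapsTo hη) hη
    have hharm : ∀ η ∈ Ω, Laplacian.laplacian (T.f m ∘ u) η = 0 := fun η hη => by
      rw [hlap η hη, hk η hη, neg_zero]
    refine ⟨fun η hη => ⟨hg2.contDiffAt (hΩ.mem_nhds hη), ?_⟩, ?_⟩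
    · filter_upwards [hΩ.mem_nhds hη] with η' hη' using hharm η' hη'
    · rintro hconn ⟨η₀, hη₀, hmax | hmin'⟩ η hη η' hη'
      · have h := BmSymplectic.eq_of_subharmonic_of_isMaxOn hΩ hg2
          (fun η hη => (hharm η hη).ge) hconn hη₀ hmax
        exact (h η hη).trans (h η' hη').symm
      · have h := hmin (fun η hη => (hk η hη).ge) hconn η₀ hη₀ hmin'
        exact (h η hη).trans (h η' hη').symm
  · rintro hk hconn ⟨η₀, hη₀, hmin'⟩ η hη η' hη'
    have h := hmin hk hconn η₀ hη₀ hmin'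
    exact (h η hη).trans (h η' hη').symm
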